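/- Let $m\ge 0$ and let $G$ be the Grassmann manifold of oriented $2$-dimensional linear subspaces of $\mathbb{R}^{2+m}$. For $P,Q\in G$ with oriented bases $u_1,u_2$ and $v_1,v_2$ put $$w(P,Q)=\frac{\langle u_1\wedge u_2,\,v_1\wedge v_2\rangle}{|u_1\wedge u_2|\,|v_1\wedge v_2|}.$$ Let $P_0,Q_0\in G$ be S-orthogonal, that is, $\dim(P_0\cap Q_0)=1$ and $w(P_0,Q_0)=0$. Let $\mathscr{S}(S)=(w(S,P_0),w(S,Q_0))$ be the associated S-map from $G$ to the closed unit disk $\overline{\mathbb{D}}\subset\mathbb{R}^2$, and let $$\mathbb{W}_0=\mathscr{S}^{-1}\big(\overline{\mathbb{D}}\setminus\{(a,0):a\le 0\}\big).$$ Theorem. Let $M$ be a connected, oriented, smooth Riemannian surface, and let $f:M\to\mathbb{R}^{2+m}$ be a smooth isometric immersion which is minimal (its mean curvature vector, the trace of the second fundamental form, vanishes identically). Suppose that $M$ is parabolic (every smooth subharmonic function on $M$ that is bounded above is constant), and that the image of the Gauss map $\gamma:M\to G$, $\gamma(x)=T_xM$, is contained in a compact subset $K$ of $\mathbb{W}_0$.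 Then $f(M)$ is contained in a $2$-dimensional affine subspace $A$ of $\mathbb{R}^{2+m}$. If moreover $M$ is complete, then $M$ is an affine plane: $f$ is an isometry (for the Riemannian distance on $M$ and the Euclidean distance) of $M$ onto $A$. -/

import Mathlib

open Bundle
open scoped Manifold ContDiff

noncomputable section

namespace MinimalSurface

/-! ### The Grassmann manifold of oriented `n`-planes -/

section Grassmannian

variable {E : Type*} [NormedAddCommGroup E] [InnerProductSpace ℝ E]

/-- The matrix `(⟨u i, v j⟩)`. Its determinant is the inner product of
`u 1 ∧ ⋯ ∧ u n` and `v 1 ∧ ⋯ ∧ v n` in the `n`-th exterior power. -/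
def innerMatrix {n : ℕ} (u v : Fin n → E) : Matrix (Fin n) (Fin n) ℝ :=
  Matrix.of fun i j => inner ℝ (u i) (v j)

/-- The tuple with entries `∑ j, A i j • v j`. -/
def changeFrame {n : ℕ} (A : Matrix (Fin n) (Fin n) ℝ) (v : Fin n → E) : Fin n → E :=
  fun i => ∑ j, A i j • v j

theorem changeFrame_one {n : ℕ} (v : Fin n → E) : changeFrame 1 v = v := by
  funext i
  simp [changeFrame, Matrix.one_apply]

theorem changeFrame_mul {n : ℕ} (A B : Matrix (Fin n) (Fin n) ℝ) (v : Fin n → E) :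
    changeFrame (A * B) v = changeFrame A (changeFrame B v) := by
  funext i
  simp only [changeFrame, Matrix.mul_apply, Finset.sum_smul, Finset.smul_sum, smul_smul]
  exact Finset.sum_comm

theorem innerMatrix_changeFrame {n : ℕ} (A B : Matrix (Fin n) (Fin n) ℝ) (u v : Fin n → E) :
    innerMatrix (changeFrame A u) (changeFrame B v) = A * innerMatrix u v * B.transpose := by
  ext i j
  simp only [innerMatrix, changeFrame, Matrix.of_apply, Matrix.mul_apply, Matrix.transpose_apply,
    sum_inner, inner_sum, real_inner_smul_left, real_inner_smul_right, Finset.sum_mul]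
  refine Finset.sum_congr rfl fun k _ => Finset.sum_congr rfl fun l _ => ?_
  ring

/-- Linearly independent `n`-tuples in `E`, with the topology of `E ^ n`. -/
abbrev Frame (n : ℕ) (E : Type*) [NormedAddCommGroup E] [InnerProductSpace ℝ E] : Type _ := {v : Fin n → E // LinearIndependent ℝ v}

/-- Two frames span the same oriented `n`-plane if they differ by a matrix of positive
determinant. -/
instance frameSetoid (n : ℕ) (E : Type*) [NormedAddCommGroup E] [InnerProductSpace ℝ E] :
    Setoid (Frame n E) where
  r u v := ∃ A : Matrix (Fin n) (Fin n) ℝ, 0 < A.det ∧ u.1 = changeFrame A v.1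
  iseqv :=
    { refl := fun u => ⟨1, by simp, (changeFrame_one _).symm⟩
      symm := by
        rintro u v ⟨A, hA, h⟩
        have hu : IsUnit A.det := hA.ne'.isUnit
        refine ⟨A⁻¹, ?_, ?_⟩
        · rw [Matrix.det_nonsing_inv, Ring.inverse_eq_inv']
          exact inv_pos.2 hA
        · rw [h, ← changeFrame_mul, Matrix.nonsing_inv_mul _ hu, changeFrame_one]
      trans := by
        rintro u v w ⟨A, hA, h⟩ ⟨B, hB, h'⟩
        exact ⟨A * B, by rw [Matrix.det_mul]; exact mul_pos hA hB, by
          rw [changeFrame_mul, ← h', h]⟩ }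

/-- The Grassmann manifold of oriented `n`-dimensional linear subspaces of `E`. -/
def OrientedGrassmannian (n : ℕ) (E : Type*) [NormedAddCommGroup E] [InnerProductSpace ℝ E] :
    Type _ := Quotient (frameSetoid n E)

/-- The manifold topology is the quotient of the topology on frames. -/
instance (n : ℕ) (E : Type*) [NormedAddCommGroup E] [InnerProductSpace ℝ E] :
    TopologicalSpace (OrientedGrassmannian n E) :=
  inferInstanceAs (TopologicalSpace (Quotient (frameSetoid n E)))

namespace OrientedGrassmannian

variable {n : ℕ}

/-- The oriented plane spanned by an oriented basis. -/
def ofFrame (v : Frame n E) : OrientedGrassmannian n E := Quotient.mk (frameSetoid n E) v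

theorem span_changeFrame_le (A : Matrix (Fin n) (Fin n) ℝ) (v : Fin n → E) :
    Submodule.span ℝ (Set.range (changeFrame A v)) ≤ Submodule.span ℝ (Set.range v) := by
  rw [Submodule.span_le]
  rintro _ ⟨i, rfl⟩
  exact Submodule.sum_mem _ fun j _ =>
    Submodule.smul_mem _ _ (Submodule.subset_span (Set.mem_range_self j))

/-- The linear subspace underlying an oriented plane. -/
def toSubmodule (P : OrientedGrassmannian n E) : Submodule ℝ E :=
  Quotient.lift (fun v : Frame n E => Submodule.span ℝ (Set.range v.1)) (by
    intro u v huv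
    apply le_antisymm
    · obtain ⟨A, -, h⟩ := huv
      simpa only [h] using span_changeFrame_le A v.1
    · obtain ⟨A, -, h⟩ := Setoid.symm huv
      simpa only [h] using span_changeFrame_le A u.1) P

/-- `⟨u, v⟩ / (|u| |v|)` for the Plücker coordinates `u 1 ∧ ⋯ ∧ u n` and `v 1 ∧ ⋯ ∧ v n`. -/
def wFrame (u v : Fin n → E) : ℝ :=
  (innerMatrix u v).det / (√(innerMatrix u u).det * √(innerMatrix v v).det)

theorem wFrame_changeFrame {A B : Matrix (Fin n) (Fin n) ℝ} (hA : 0 < A.det) (hB : 0 < B.det)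
    (u v : Fin n → E) : wFrame (changeFrame A u) (changeFrame B v) = wFrame u v := by
  have key : ∀ {C : Matrix (Fin n) (Fin n) ℝ} (_ : 0 < C.det) (z : Fin n → E),
      √(innerMatrix (changeFrame C z) (changeFrame C z)).det
        = C.det * √(innerMatrix z z).det := by
    intro C hC z
    have h : (innerMatrix (changeFrame C z) (changeFrame C z)).det
        = C.det ^ 2 * (innerMatrix z z).det := by
      rw [innerMatrix_changeFrame, Matrix.det_mul, Matrix.det_mul, Matrix.det_transpose]
      ring
    rw [h, Real.sqrt_mul (sq_nonneg _), Real.sqrt_sq hC.le]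
  unfold wFrame
  rw [key hA, key hB, innerMatrix_changeFrame, Matrix.det_mul, Matrix.det_mul,
    Matrix.det_transpose]
  have h1 : A.det * (innerMatrix u v).det * B.det
      = (A.det * B.det) * (innerMatrix u v).det := by ring
  have h2 : A.det * √(innerMatrix u u).det * (B.det * √(innerMatrix v v).det)
      = (A.det * B.det) * (√(innerMatrix u u).det * √(innerMatrix v v).det) := by ring
  rw [h1, h2, mul_div_mul_left _ _ (mul_pos hA hB).ne']

/-- The function `w(P, Q)`: the normalized inner product of the Plücker coordinates. -/
def w (P Q : OrientedGrassmannian n E) : ℝ :=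
  Quotient.lift₂ (fun u v : Frame n E => wFrame u.1 v.1) (by
    rintro u v u' v' ⟨A, hA, h⟩ ⟨B, hB, h'⟩
    simp only [h, h']
    exact wFrame_changeFrame hA hB _ _) P Q

/-- `P` and `Q` are S-orthogonal: `dim (P ∩ Q) = n - 1` and `w(P, Q) = 0`. -/
def SOrthogonal (P Q : OrientedGrassmannian n E) : Prop :=
  Module.finrank ℝ (P.toSubmodule ⊓ Q.toSubmodule : Submodule ℝ E) + 1 = n ∧ w P Q = 0

/-- The S-map relative to `P` and `Q`. -/
def sMap (P Q S : OrientedGrassmannian n E) : ℝ × ℝ := (w S P, w S Q)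

/-- The closed disk of radius `c` (for `c ≥ 0`) about the origin of the plane. -/
def closedDisk (c : ℝ) : Set (ℝ × ℝ) := {x | x.1 ^ 2 + x.2 ^ 2 ≤ c ^ 2}

/-- The set `𝕎_c` relative to `P` and `Q`: the preimage under the S-map of the closed unit disk
with the closed disk of radius `c` and the radius `{(a, 0) : a ≤ 0}` removed. -/
def W (P Q : OrientedGrassmannian n E) (c : ℝ) : Set (OrientedGrassmannian n E) :=
  sMap P Q ⁻¹' (closedDisk 1 \ (closedDisk c ∪ {x | x.1 ≤ 0 ∧ x.2 = 0}))

end OrientedGrassmannian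

end Grassmannian

/-! ### Riemannian manifolds and immersed submanifolds of Euclidean space -/

/-- The `i`-th standard basis vector. -/
abbrev stdVec {n : ℕ} (i : Fin n) : EuclideanSpace ℝ (Fin n) := EuclideanSpace.single i 1

section Manifold

variable (n : ℕ) (M : Type*) [TopologicalSpace M] [ChartedSpace (EuclideanSpace ℝ (Fin n)) M]

/-- The atlas of `M` is oriented: all coordinate changes have positive Jacobian determinant. The
orientation of `M` is then the one for which all these charts preserve orientation. -/
def IsOrientedAtlas : Prop :=
  ∀ e ∈ atlas (EuclideanSpace ℝ (Fin n)) M, ∀ e' ∈ atlas (EuclideanSpace ℝ (Fin n)) M,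
    ∀ p ∈ (e.symm.trans e').source, 0 < (fderiv ℝ (e.symm.trans e') p).det

variable {n M}

/-- The chart of `M` around `x`. -/
abbrev chart (x : M) : OpenPartialHomeomorph M (EuclideanSpace ℝ (Fin n)) :=
  chartAt (EuclideanSpace ℝ (Fin n)) x

section Metric

variable [RiemannianBundle (fun x : M => TangentSpace (𝓡 n) x)]

/-- The coordinate vector field `∂ i` of the chart around `x`, at the point with coordinates `p`. -/
def coordVector (x : M) (p : EuclideanSpace ℝ (Fin n)) (i : Fin n) :
    TangentSpace (𝓡 n) ((chart x).symm p) :=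
  mfderiv (𝓡 n) (𝓡 n) (chart x).symm p (stdVec i)

/-- The matrix `g i j = ⟨∂ i, ∂ j⟩` of the Riemannian metric in the chart around `x`. -/
def coordMetric (x : M) (p : EuclideanSpace ℝ (Fin n)) : Matrix (Fin n) (Fin n) ℝ :=
  Matrix.of fun i j => inner ℝ (coordVector x p i) (coordVector x p j)

variable (n) in
/-- The Laplace–Beltrami operator `(det g)^(-1/2) ∂ i ((det g)^(1/2) g^(ij) ∂ j u)`; at the point
`x` it is computed in the chart around `x`. -/
def laplaceBeltrami (u : M → ℝ) (x : M) : ℝ :=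
  (√(coordMetric (n := n) x (chart x x)).det)⁻¹ *
    ∑ i, fderiv ℝ (fun p : EuclideanSpace ℝ (Fin n) => √(coordMetric x p).det *
      ∑ j, (coordMetric x p)⁻¹ i j * fderiv ℝ (u ∘ (chart x).symm) p (stdVec j))
        (chart x x) (stdVec i)

variable (n M) in
/-- `M` is parabolic: every subharmonic function on `M` that is bounded above is constant. -/
def IsParabolic : Prop :=
  ∀ u : M → ℝ, ContMDiff (𝓡 n) 𝓘(ℝ, ℝ) ∞ u → BddAbove (Set.range u) →
    (∀ x, 0 ≤ laplaceBeltrami n u x) → ∃ c, ∀ x, u x = c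

variable {E : Type*} [NormedAddCommGroup E] [InnerProductSpace ℝ E]

/-- A smooth map `M → E` is an isometric immersion if its differential preserves inner products. -/
structure IsIsometricImmersion (f : M → E) : Prop where
  contMDiff : ContMDiff (𝓡 n) 𝓘(ℝ, E) ∞ f
  inner_mfderiv : ∀ (x : M) (v v' : TangentSpace (𝓡 n) x),
    inner (E := E) ℝ (mfderiv (𝓡 n) 𝓘(ℝ, E) f x v) (mfderiv (𝓡 n) 𝓘(ℝ, E) f x v') = inner ℝ v v'

/-- The coordinate basis `∂ 1 f, …, ∂ n f` of the tangent space of the immersed submanifold at `x`,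
as vectors in `E`. -/
def tangentFrame (f : M → E) (x : M) (i : Fin n) : E :=
  fderiv ℝ (f ∘ (chart x).symm) (chart x x) (stdVec i)

/-- The tangent space of the immersed submanifold at `x`, translated to the origin. -/
def tangentPlane (f : M → E) (x : M) : Submodule ℝ E :=
  Submodule.span ℝ (Set.range (tangentFrame (n := n) f x))

instance (f : M → E) (x : M) : FiniteDimensional ℝ (tangentPlane (n := n) f x) :=
  FiniteDimensional.span_of_finite ℝ (Set.finite_range _)

/-- The second fundamental form `B(∂ i, ∂ j)`: the normal component of `∂ i ∂ j f`. -/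
def secondFundamentalForm (f : M → E) (x : M) (i j : Fin n) : E :=
  (tangentPlane (n := n) f x)ᗮ.starProjection
    (fderiv ℝ (fderiv ℝ (f ∘ (chart x).symm)) (chart x x) (stdVec i) (stdVec j))

/-- The mean curvature vector: the trace of the second fundamental form. -/
def meanCurvature (f : M → E) (x : M) : E :=
  ∑ i, ∑ j, (coordMetric (n := n) x (chart x x))⁻¹ i j • secondFundamentalForm f x i j

/-- The immersed submanifold is minimal: its mean curvature vanishes. -/
def IsMinimal (f : M → E) : Prop := ∀ x, meanCurvature (n := n) f x = 0

theorem linearIndependent_tangentFrame [IsManifold (𝓡 n) ∞ M] {f : M → E}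
    (hf : IsIsometricImmersion (n := n) f) (x : M) :
    LinearIndependent ℝ (tangentFrame (n := n) f x) := by
  have hd : MDifferentiableAt (𝓡 n) 𝓘(ℝ, E) f x :=
    (hf.contMDiff x).mdifferentiableAt (by simp)
  have h1 : fderiv ℝ (f ∘ (chart x).symm) (chart x x) = mfderiv (𝓡 n) 𝓘(ℝ, E) f x := by
    rw [hd.mfderiv]
    simp [writtenInExtChartAt, Function.comp_def, chartAt_self_eq]
  have h2 : LinearMap.ker (mfderiv (𝓡 n) 𝓘(ℝ, E) f x).toLinearMap = ⊥ := by
    rw [LinearMap.ker_eq_bot']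
    intro v hv
    have hv' : (mfderiv (𝓡 n) 𝓘(ℝ, E) f x v : E) = 0 := hv
    have h : inner ℝ v v = (0 : ℝ) := (hf.inner_mfderiv x v v).symm.trans
      ((congrArg (fun z : E => inner (E := E) ℝ z z) hv').trans (inner_zero_left (𝕜 := ℝ) (0 : E)))
    exact inner_self_eq_zero.1 h
  have h3 : LinearIndependent ℝ (stdVec : Fin n → EuclideanSpace ℝ (Fin n)) := by
    have := (EuclideanSpace.basisFun (Fin n) ℝ).toBasis.linearIndependent
    have h : ((EuclideanSpace.basisFun (Fin n) ℝ).toBasis : Fin n → EuclideanSpace ℝ (Fin n))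
        = stdVec := by
      funext i
      simp [stdVec]
    rwa [h] at this
  have h4 := h3.map' (fderiv ℝ (f ∘ (chart x).symm) (chart x x)).toLinearMap (by
    rw [h1]; exact h2)
  exact h4

/-- The Gauss map `x ↦ T_x M`, where `T_x M` is oriented by the coordinate basis of the chart
around `x` (a positively oriented basis when the atlas is oriented). -/
def gaussMap [IsManifold (𝓡 n) ∞ M] (f : M → E) (hf : IsIsometricImmersion (n := n) f) (x : M) :
    OrientedGrassmannian n E :=
  OrientedGrassmannian.ofFrame ⟨tangentFrame (n := n) f x, linearIndependent_tangentFrame hf x⟩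

end Metric

end Manifold

end MinimalSurface

end

open MinimalSurface

/-! Choose a nonzero vector `b` in `P ∩ Q`. If `b` were orthogonal to an oriented plane `S`, the
matrices of inner products computing `w(S, P)` and `w(S, Q)` would be singular, so the S-map would
send `S` to the origin, which `𝕎_0` excludes. By compactness of `K`, the tangential part `b'` of `b`
satisfies `|b'|² ≥ δ > 0` along all of `M` (`exists_projSq_bound`).

Coordinate functions of a minimal surface are harmonic (`div_fluxVector`), so for a fixed vector `a`
both `d⟨f, a⟩` and its Hodge dual `*d⟨f, a⟩` are closed. Write `d⟨f, a⟩ = α d⟨f, b⟩ + β *d⟨f, b⟩`.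
Then `α - iβ` is the quotient of the holomorphic forms `d⟨f, a⟩ + i *d⟨f, a⟩` and `d⟨f, b⟩ + i *d⟨f,
b⟩`, hence holomorphic (`cauchyRiemann_frame`), and `α`, `β` are harmonic. This is done by linear
algebra in arbitrary coordinates, without isothermal ones. Moreover `α² + β² = |a'|² / |b'|² ≤ |a|²
/ δ`, so parabolicity makes `α` and `β` constant.

If `a` is normal at one point, both constants are zero, so `a` is normal everywhere
(`inner_tangentFrame_eq_zero`) and `⟨f, a⟩` is constant. Letting `a` run through the normal space at
`x₀` puts `f(M)` in the affine tangent plane at `x₀` (`sub_mem_tangentPlane`).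

With values in that plane, `f` is a local isometry in codimension zero. If `M` is complete, segments
lift to `M`; the lifts from one point give a continuous section of `f` with open and closed range,
so `f` is bijective, and lifting segments once more shows that it preserves distances
(`isometry_surjective_of_complete`). -/

noncomputable section

namespace MinimalSurface

open Filter Topology

/-! ### Harmonic functions in local coordinates of a surface -/

section Coordinates

/-- The flux `√(det g) g⁻¹ a` of a covector `a` with respect to a metric `g`. -/
def flux (g : Matrix (Fin 2) (Fin 2) ℝ) (a : Fin 2 → ℝ) (i : Fin 2) : ℝ :=
  √g.det * ∑ j, g⁻¹ i j * a j

theorem flux_zero {g : Matrix (Fin 2) (Fin 2) ℝ} (hg : 0 < g.det) (a : Fin 2 → ℝ) :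
    flux g a 0 = (g 1 1 * a 0 - g 0 1 * a 1) / √g.det := by
  have h : √g.det ≠ 0 := (Real.sqrt_pos.2 hg).ne'
  have h2 : g.det⁻¹ = (√g.det)⁻¹ * (√g.det)⁻¹ := by
    rw [← mul_inv, Real.mul_self_sqrt hg.le]
  simp only [flux, Matrix.inv_def, Ring.inverse_eq_inv', Matrix.adjugate_fin_two, Fin.sum_univ_two,
    Matrix.smul_apply, Matrix.of_apply, Matrix.cons_val', Matrix.cons_val_zero,
    Matrix.cons_val_one, Matrix.cons_val_fin_one, smul_eq_mul, h2]
  field_simp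
  ring

theorem flux_one {g : Matrix (Fin 2) (Fin 2) ℝ} (hg : 0 < g.det) (a : Fin 2 → ℝ) :
    flux g a 1 = (g 0 0 * a 1 - g 1 0 * a 0) / √g.det := by
  have h : √g.det ≠ 0 := (Real.sqrt_pos.2 hg).ne'
  have h2 : g.det⁻¹ = (√g.det)⁻¹ * (√g.det)⁻¹ := by
    rw [← mul_inv, Real.mul_self_sqrt hg.le]
  simp only [flux, Matrix.inv_def, Ring.inverse_eq_inv', Matrix.adjugate_fin_two, Fin.sum_univ_two,
    Matrix.smul_apply, Matrix.of_apply, Matrix.cons_val', Matrix.cons_val_zero,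
    Matrix.cons_val_one, Matrix.cons_val_fin_one, smul_eq_mul, h2]
  field_simp
  ring

/-- Both sides are `√(det g)` times the inner product of the covectors `θ` and `c`. -/
theorem flux_symm {g : Matrix (Fin 2) (Fin 2) ℝ} (hg : 0 < g.det) (hs : g 1 0 = g 0 1)
    (θ c : Fin 2 → ℝ) : c 0 * flux g θ 0 + c 1 * flux g θ 1
      = θ 0 * flux g c 0 + θ 1 * flux g c 1 := by
  have hσ : √g.det ≠ 0 := (Real.sqrt_pos.2 hg).ne'
  have e0 : ∀ c, flux g c 0 * √g.det = g 1 1 * c 0 - g 0 1 * c 1 := fun c => by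
    rw [flux_zero hg, div_mul_cancel₀ _ hσ]
  have e1 : ∀ c, flux g c 1 * √g.det = g 0 0 * c 1 - g 0 1 * c 0 := fun c => by
    rw [flux_one hg, div_mul_cancel₀ _ hσ, hs]
  apply mul_right_cancel₀ hσ
  linear_combination c 0 * e0 θ + c 1 * e1 θ - θ 0 * e0 c - θ 1 * e1 c

/-- In dimension two `√(det g) g⁻¹` has determinant one. Equivalently, the Hodge star, which sends
`θ` to `(-flux g θ 1, flux g θ 0)`, preserves wedge products of covectors. -/
theorem flux_cross {g : Matrix (Fin 2) (Fin 2) ℝ} (hg : 0 < g.det) (hs : g 1 0 = g 0 1)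
    (θ c : Fin 2 → ℝ) : flux g θ 0 * flux g c 1 - flux g θ 1 * flux g c 0
      = θ 0 * c 1 - θ 1 * c 0 := by
  have hσ : √g.det ≠ 0 := (Real.sqrt_pos.2 hg).ne'
  have e0 : ∀ c, flux g c 0 * √g.det = g 1 1 * c 0 - g 0 1 * c 1 := fun c => by
    rw [flux_zero hg, div_mul_cancel₀ _ hσ]
  have e1 : ∀ c, flux g c 1 * √g.det = g 0 0 * c 1 - g 0 1 * c 0 := fun c => by
    rw [flux_one hg, div_mul_cancel₀ _ hσ, hs]
  have hd : g 0 0 * g 1 1 - g 0 1 * g 0 1 = √g.det * √g.det := by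
    rw [Real.mul_self_sqrt hg.le, Matrix.det_fin_two, hs]
  apply mul_right_cancel₀ (mul_ne_zero hσ hσ)
  linear_combination flux g c 1 * √g.det * e0 θ + (g 1 1 * θ 0 - g 0 1 * θ 1) * e1 c
    - flux g c 0 * √g.det * e1 θ - (g 0 0 * θ 1 - g 0 1 * θ 0) * e0 c
    + (θ 0 * c 1 - θ 1 * c 0) * hd

/-- The hypotheses read `a ∧ θ + b ∧ *θ = 0` and `a ∧ *θ - b ∧ θ = 0`. Moving the star across the
wedge products turns them into a homogeneous linear system for `*a + b`, whose determinant is `|θ|²`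
up to sign and the factor `√(det g)`; the same holds for `*b - a`. -/
theorem flux_eq_of_cauchyRiemann {g : Matrix (Fin 2) (Fin 2) ℝ} (hg : 0 < g.det)
    (hs : g 1 0 = g 0 1) {θ a b : Fin 2 → ℝ}
    (hn : flux g θ 0 * θ 0 + flux g θ 1 * θ 1 ≠ 0)
    (h1 : a 0 * θ 1 - a 1 * θ 0 + b 0 * flux g θ 0 + b 1 * flux g θ 1 = 0)
    (h2 : a 0 * flux g θ 0 + a 1 * flux g θ 1 - b 0 * θ 1 + b 1 * θ 0 = 0) :
    (flux g a 0 = -b 1 ∧ flux g a 1 = b 0) ∧ (flux g b 0 = a 1 ∧ flux g b 1 = -a 0) := by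
  have sym := flux_symm hg hs θ
  have cross := flux_cross hg hs θ
  have solve : ∀ x y : ℝ, θ 0 * x + θ 1 * y = 0 → flux g θ 1 * x - flux g θ 0 * y = 0 →
      x = 0 ∧ y = 0 := by
    intro x y h h'
    constructor
    · apply mul_right_cancel₀ hn
      linear_combination flux g θ 0 * h + θ 1 * h'
    · apply mul_right_cancel₀ hn
      linear_combination flux g θ 1 * h - θ 0 * h'
  refine ⟨?_, ?_⟩
  · obtain ⟨hx, hy⟩ := solve (flux g a 0 + b 1) (flux g a 1 - b 0)
      (by linear_combination h2 - sym a) (by linear_combination h1 - cross a)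
    exact ⟨by linarith, by linarith⟩
  · obtain ⟨hx, hy⟩ := solve (flux g b 0 - a 1) (flux g b 1 + a 0)
      (by linear_combination h1 - sym b) (by linear_combination -h2 - cross b)
    exact ⟨by linarith, by linarith⟩

local notation "ℝ²" => EuclideanSpace ℝ (Fin 2)

variable {E : Type*} [NormedAddCommGroup E] [InnerProductSpace ℝ E]

/-- Take the exterior derivatives of `a = α θ + β *θ` and `*a = α *θ - β θ`, with `V` and `A` the
fluxes of `θ` and `a`. As `θ`, `*θ`, `a` and `*a` are closed at `p`, only the terms with `dα` and
`dβ` survive. -/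
theorem cauchyRiemann_of_closed {θ₀ θ₁ V₀ V₁ a₀ a₁ A₀ A₁ α β : ℝ² → ℝ} {p : ℝ²}
    (hθ₀ : DifferentiableAt ℝ θ₀ p) (hθ₁ : DifferentiableAt ℝ θ₁ p)
    (hV₀ : DifferentiableAt ℝ V₀ p) (hV₁ : DifferentiableAt ℝ V₁ p)
    (hα : DifferentiableAt ℝ α p) (hβ : DifferentiableAt ℝ β p)
    (h1 : a₀ =ᶠ[𝓝 p] fun q => α q * θ₀ q - β q * V₁ q)
    (h2 : a₁ =ᶠ[𝓝 p] fun q => α q * θ₁ q + β q * V₀ q)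
    (h3 : A₀ =ᶠ[𝓝 p] fun q => α q * V₀ q - β q * θ₁ q)
    (h4 : A₁ =ᶠ[𝓝 p] fun q => α q * V₁ q + β q * θ₀ q)
    (cθ : fderiv ℝ θ₁ p (stdVec 0) = fderiv ℝ θ₀ p (stdVec 1))
    (ca : fderiv ℝ a₁ p (stdVec 0) = fderiv ℝ a₀ p (stdVec 1))
    (dV : fderiv ℝ V₀ p (stdVec 0) + fderiv ℝ V₁ p (stdVec 1) = 0)
    (dA : fderiv ℝ A₀ p (stdVec 0) + fderiv ℝ A₁ p (stdVec 1) = 0) :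
    (fderiv ℝ α p (stdVec 0) * θ₁ p - fderiv ℝ α p (stdVec 1) * θ₀ p
      + fderiv ℝ β p (stdVec 0) * V₀ p + fderiv ℝ β p (stdVec 1) * V₁ p = 0) ∧
    (fderiv ℝ α p (stdVec 0) * V₀ p + fderiv ℝ α p (stdVec 1) * V₁ p
      - fderiv ℝ β p (stdVec 0) * θ₁ p + fderiv ℝ β p (stdVec 1) * θ₀ p = 0) := by
  rw [h1.fderiv_eq, h2.fderiv_eq, fderiv_fun_add (hα.fun_mul hθ₁) (hβ.fun_mul hV₀),
    fderiv_fun_sub (hα.fun_mul hθ₀) (hβ.fun_mul hV₁), fderiv_fun_mul hα hθ₁, fderiv_fun_mul hβ hV₀,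
    fderiv_fun_mul hα hθ₀, fderiv_fun_mul hβ hV₁] at ca
  rw [h3.fderiv_eq, h4.fderiv_eq, fderiv_fun_add (hα.fun_mul hV₁) (hβ.fun_mul hθ₀),
    fderiv_fun_sub (hα.fun_mul hV₀) (hβ.fun_mul hθ₁), fderiv_fun_mul hα hV₀, fderiv_fun_mul hβ hθ₁,
    fderiv_fun_mul hα hV₁, fderiv_fun_mul hβ hθ₀] at dA
  simp only [add_apply, sub_apply, smul_apply,
    smul_eq_mul] at ca dA
  constructor
  · linear_combination ca - α p * cθ - β p * dV
  · linear_combination dA + β p * cθ - α p * dV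

/-- The divergence of the field conjugate to a gradient vanishes. -/
theorem div_conjugate_gradient {b : ℝ² → ℝ} {p : ℝ²} (hb : ContDiffAt ℝ ∞ b p) {X Y : ℝ² → ℝ}
    (hX : X =ᶠ[𝓝 p] fun q => -fderiv ℝ b q (stdVec 1))
    (hY : Y =ᶠ[𝓝 p] fun q => fderiv ℝ b q (stdVec 0)) :
    fderiv ℝ X p (stdVec 0) + fderiv ℝ Y p (stdVec 1) = 0 := by
  have hd : DifferentiableAt ℝ (fderiv ℝ b) p :=
    (hb.fderiv_right (m := 1) (by norm_cast)).differentiableAt (by simp)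
  have hsymm : IsSymmSndFDerivAt ℝ b p := hb.isSymmSndFDerivAt (by
    simp only [minSmoothness_of_isRCLikeNormedField]; exact ENat.LEInfty.out)
  rw [hX.fderiv_eq, hY.fderiv_eq, fderiv_fun_neg,
    fderiv_clm_apply hd (differentiableAt_const _), fderiv_clm_apply hd (differentiableAt_const _)]
  simp [hsymm.eq (stdVec 0) (stdVec 1)]

end Coordinates

end MinimalSurface

namespace MinimalSurface

open Filter Topology

/-! ### Frames of planes -/

section Frames

variable {E : Type*} [NormedAddCommGroup E] [InnerProductSpace ℝ E]

/-- `√(det g)` times the inner product of the tangential parts of `a` and `b`. -/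
def frameForm (t : Fin 2 → E) (a b : E) : ℝ :=
  ∑ i, flux (innerMatrix t t) (fun j => inner ℝ (t j) a) i * inner ℝ (t i) b

/-- `√(det g)` times the area form of the tangential parts of `a` and `b`. -/
def frameCross (t : Fin 2 → E) (a b : E) : ℝ :=
  inner ℝ (t 0) a * inner ℝ (t 1) b - inner ℝ (t 1) a * inner ℝ (t 0) b

theorem innerMatrix_symm (t : Fin 2 → E) : innerMatrix t t 1 0 = innerMatrix t t 0 1 := by
  simp [innerMatrix, real_inner_comm]

theorem det_innerMatrix (t : Fin 2 → E) : (innerMatrix t t).det =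
    inner ℝ (t 0) (t 0) * inner ℝ (t 1) (t 1) - inner ℝ (t 0) (t 1) * inner ℝ (t 0) (t 1) := by
  rw [Matrix.det_fin_two, innerMatrix_symm]
  rfl

theorem det_innerMatrix_pos {t : Fin 2 → E} (ht : LinearIndependent ℝ t) :
    0 < (innerMatrix t t).det := by
  rw [det_innerMatrix]
  have h0 : t 0 ≠ 0 := ht.ne_zero 0
  have hpos : 0 < inner ℝ (t 0) (t 0) := real_inner_self_pos.2 h0
  -- Up to the factor `-|t 0|²`, this is the component of `t 1` orthogonal to `t 0`; its squared
  -- length is `|t 0|²` times the Gram determinant.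
  set z : E := inner ℝ (t 0) (t 1) • t 0 - inner ℝ (t 0) (t 0) • t 1 with hz
  have hz0 : z ≠ 0 := by
    intro h
    rw [hz] at h
    have := Fintype.linearIndependent_iff.1 ht ![inner ℝ (t 0) (t 1), -inner ℝ (t 0) (t 0)]
      (by simpa [Fin.sum_univ_two, sub_eq_add_neg] using h) 1
    simp [h0] at this
  have hzz : 0 < inner ℝ z z := real_inner_self_pos.2 hz0
  have : inner ℝ z z = inner ℝ (t 0) (t 0) * (inner ℝ (t 0) (t 0) * inner ℝ (t 1) (t 1)
      - inner ℝ (t 0) (t 1) * inner ℝ (t 0) (t 1)) := by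
    simp only [hz, inner_sub_left, inner_sub_right, real_inner_smul_left, real_inner_smul_right,
      real_inner_comm (t 0) (t 1)]
    ring
  rw [this] at hzz
  exact pos_of_mul_pos_right hzz hpos.le

theorem frameForm_eq {t : Fin 2 → E} (ht : 0 < (innerMatrix t t).det) (a b : E) :
    frameForm t a b = (inner ℝ (t 1) (t 1) * inner ℝ (t 0) a * inner ℝ (t 0) b
      - inner ℝ (t 0) (t 1) * (inner ℝ (t 0) a * inner ℝ (t 1) b + inner ℝ (t 1) a * inner ℝ (t 0) b)
      + inner ℝ (t 0) (t 0) * inner ℝ (t 1) a * inner ℝ (t 1) b) / √(innerMatrix t t).det := by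
  rw [frameForm, Fin.sum_univ_two, flux_zero ht, flux_one ht, innerMatrix_symm]
  simp only [innerMatrix, Matrix.of_apply]
  ring

theorem inner_changeFrame (A : Matrix (Fin 2) (Fin 2) ℝ) (t : Fin 2 → E) (i : Fin 2) (e : E) :
    inner ℝ (changeFrame A t i) e = A i 0 * inner ℝ (t 0) e + A i 1 * inner ℝ (t 1) e := by
  simp [changeFrame, Fin.sum_univ_two, inner_add_left, real_inner_smul_left]

theorem frameCross_changeFrame (A : Matrix (Fin 2) (Fin 2) ℝ) (t : Fin 2 → E) (a b : E) :
    frameCross (changeFrame A t) a b = A.det * frameCross t a b := by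
  simp only [frameCross, inner_changeFrame, Matrix.det_fin_two]
  ring

/-- The quadratic numerator in `frameForm_eq` scales by `det A ^ 2` and the area density below it by
`det A`. The common factor left over is the one in `frameCross_changeFrame`, so the quotients
`frameRe` and `frameIm` depend only on the oriented plane. -/
theorem frameForm_changeFrame {A : Matrix (Fin 2) (Fin 2) ℝ} (hA : 0 < A.det) {t : Fin 2 → E}
    (ht : 0 < (innerMatrix t t).det) (a b : E) :
    frameForm (changeFrame A t) a b = A.det * frameForm t a b := by
  have h : (innerMatrix (changeFrame A t) (changeFrame A t)).det
      = A.det ^ 2 * (innerMatrix t t).det := by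
    rw [innerMatrix_changeFrame, Matrix.det_mul, Matrix.det_mul, Matrix.det_transpose]
    ring
  have h' : 0 < (innerMatrix (changeFrame A t) (changeFrame A t)).det := by rw [h]; positivity
  have hσ : √(innerMatrix t t).det ≠ 0 := (Real.sqrt_pos.2 ht).ne'
  rw [frameForm_eq h', frameForm_eq ht, h, Real.sqrt_mul (sq_nonneg _), Real.sqrt_sq hA.le]
  simp only [inner_changeFrame, real_inner_comm (changeFrame A t _) (t _)]
  have hA0 := hA.ne'
  rw [real_inner_comm (t 0) (t 1)]
  field_simp
  rw [Matrix.det_fin_two]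
  ring

/-- The function `⟨a', b'⟩ / |b'|²` of the tangential parts of `a` and `b`. -/
def frameRe (t : Fin 2 → E) (b a : E) : ℝ := frameForm t a b / frameForm t b b

/-- The function `⟨a', J b'⟩ / |b'|²` of the tangential parts of `a` and `b`, where `J` is the
rotation by a right angle. -/
def frameIm (t : Fin 2 → E) (b a : E) : ℝ := frameCross t b a / frameForm t b b

theorem frameRe_changeFrame {A : Matrix (Fin 2) (Fin 2) ℝ} (hA : 0 < A.det) {t : Fin 2 → E}
    (ht : 0 < (innerMatrix t t).det) (b a : E) :
    frameRe (changeFrame A t) b a = frameRe t b a := by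
  rw [frameRe, frameRe, frameForm_changeFrame hA ht, frameForm_changeFrame hA ht,
    mul_div_mul_left _ _ hA.ne']

theorem frameIm_changeFrame {A : Matrix (Fin 2) (Fin 2) ℝ} (hA : 0 < A.det) {t : Fin 2 → E}
    (ht : 0 < (innerMatrix t t).det) (b a : E) :
    frameIm (changeFrame A t) b a = frameIm t b a := by
  rw [frameIm, frameIm, frameCross_changeFrame, frameForm_changeFrame hA ht,
    mul_div_mul_left _ _ hA.ne']

theorem frameForm_self_nonneg {t : Fin 2 → E} (ht : 0 < (innerMatrix t t).det) (a : E) :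
    0 ≤ frameForm t a a := by
  rw [frameForm_eq ht]
  refine div_nonneg ?_ (Real.sqrt_nonneg _)
  rw [det_innerMatrix] at ht
  have h0 : (0:ℝ) ≤ inner ℝ (t 0) (t 0) := real_inner_self_nonneg
  have hp : (0:ℝ) < inner ℝ (t 0) (t 0) := by
    refine h0.lt_of_ne fun h => ?_
    rw [← h] at ht
    nlinarith [mul_self_nonneg (inner ℝ (t 0) (t 1) : ℝ)]
  -- Multiplication by `|t 0|²` allows completing the square.
  refine (mul_nonneg_iff_of_pos_left hp).1 ?_
  have : ∀ x y z u v : ℝ, 0 ≤ x * z - y * y →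
      0 ≤ x * (z * u * u - y * (u * v + v * u) + x * v * v) := by
    intro x y z u v h
    have : x * (z * u * u - y * (u * v + v * u) + x * v * v)
      = (x * v - y * u) ^ 2 + (x * z - y * y) * u ^ 2 := by ring
    rw [this]; positivity
  exact this _ _ _ _ _ ht.le

theorem inner_eq_zero_of_frameForm_self {t : Fin 2 → E} (ht : 0 < (innerMatrix t t).det) {a : E}
    (h : frameForm t a a = 0) (i : Fin 2) : inner ℝ (t i) a = 0 := by
  rw [frameForm_eq ht, div_eq_zero_iff, or_iff_left (Real.sqrt_pos.2 ht).ne'] at h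
  rw [det_innerMatrix] at ht
  generalize inner ℝ (t 0) (t 0) = x at *
  generalize inner ℝ (t 0) (t 1) = y at *
  generalize inner ℝ (t 1) (t 1) = z at *
  have h0 : (x * inner ℝ (t 1) a - y * inner ℝ (t 0) a) ^ 2
      + (x * z - y * y) * (inner ℝ (t 0) a) ^ 2 = 0 := by linear_combination x * h
  have h1 : (z * inner ℝ (t 0) a - y * inner ℝ (t 1) a) ^ 2
      + (x * z - y * y) * (inner ℝ (t 1) a) ^ 2 = 0 := by linear_combination z * h
  have k0 : (inner ℝ (t 0) a : ℝ) = 0 := by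
    by_contra hne
    have : 0 < (x * z - y * y) * (inner ℝ (t 0) a) ^ 2 := by positivity
    nlinarith [sq_nonneg (x * inner ℝ (t 1) a - y * inner ℝ (t 0) a)]
  have k1 : (inner ℝ (t 1) a : ℝ) = 0 := by
    by_contra hne
    have : 0 < (x * z - y * y) * (inner ℝ (t 1) a) ^ 2 := by positivity
    nlinarith [sq_nonneg (z * inner ℝ (t 0) a - y * inner ℝ (t 1) a)]
  fin_cases i
  exacts [k0, k1]

/-- The tangential part of a vector is at most as long as the vector. -/
theorem frameForm_self_le {t : Fin 2 → E} (ht : 0 < (innerMatrix t t).det) (a : E) :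
    frameForm t a a ≤ √(innerMatrix t t).det * ‖a‖ ^ 2 := by
  rcases (frameForm_self_nonneg ht a).eq_or_lt with h | h
  · rw [← h]; positivity
  have hσ : 0 < √(innerMatrix t t).det := Real.sqrt_pos.2 ht
  have hσ2 : √(innerMatrix t t).det * √(innerMatrix t t).det = inner ℝ (t 0) (t 0) *
      inner ℝ (t 1) (t 1) - inner ℝ (t 0) (t 1) * inner ℝ (t 0) (t 1) := by
    rw [Real.mul_self_sqrt ht.le, det_innerMatrix]
  set σ := √(innerMatrix t t).det with hσdef
  have hN : frameForm t a a * σ = inner ℝ (t 1) (t 1) * inner ℝ (t 0) a * inner ℝ (t 0) a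
      - inner ℝ (t 0) (t 1) * (inner ℝ (t 0) a * inner ℝ (t 1) a + inner ℝ (t 1) a * inner ℝ (t 0) a)
      + inner ℝ (t 0) (t 0) * inner ℝ (t 1) a * inner ℝ (t 1) a := by
    rw [frameForm_eq ht, div_mul_cancel₀ _ hσ.ne']
  -- `z` is `det g` times the tangential part of `a`; Cauchy-Schwarz for `z` and `a` gives the
  -- estimate.
  set z : E := (inner ℝ (t 1) (t 1) * inner ℝ (t 0) a - inner ℝ (t 0) (t 1) * inner ℝ (t 1) a) • t 0
    + (inner ℝ (t 0) (t 0) * inner ℝ (t 1) a - inner ℝ (t 0) (t 1) * inner ℝ (t 0) a) • t 1 with hz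
  have hza : inner ℝ z a = frameForm t a a * σ := by
    rw [hN]
    simp only [hz, inner_add_left, real_inner_smul_left]
    ring
  have hzz : inner ℝ z z = (σ * σ) * (frameForm t a a * σ) := by
    rw [hN, hσ2]
    simp only [hz, inner_add_left, inner_add_right, real_inner_smul_left, real_inner_smul_right,
      real_inner_comm (t 0) (t 1)]
    ring
  have hcs := real_inner_mul_inner_self_le z a
  rw [hza, hzz, real_inner_self_eq_norm_sq a] at hcs
  have hp : 0 < frameForm t a a * σ * (σ * σ) := by positivity
  nlinarith

/-- Lagrange's identity in the plane: squared inner product plus squared area equals the product of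
the squared lengths. -/
theorem frameForm_sq_add_frameCross_sq {t : Fin 2 → E} (ht : 0 < (innerMatrix t t).det) (a b : E) :
    frameForm t a b ^ 2 + frameCross t b a ^ 2 = frameForm t a a * frameForm t b b := by
  have hσ : 0 < √(innerMatrix t t).det := Real.sqrt_pos.2 ht
  have hσ2 : √(innerMatrix t t).det ^ 2 = inner ℝ (t 0) (t 0) *
      inner ℝ (t 1) (t 1) - inner ℝ (t 0) (t 1) * inner ℝ (t 0) (t 1) := by
    rw [Real.sq_sqrt ht.le, det_innerMatrix]
  rw [frameForm_eq ht, frameForm_eq ht, frameForm_eq ht, frameCross]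
  field_simp
  rw [hσ2]
  ring

theorem frameRe_sq_add_frameIm_sq_le {t : Fin 2 → E} (ht : 0 < (innerMatrix t t).det) {a b : E}
    (hb : 0 < frameForm t b b) :
    frameRe t b a ^ 2 + frameIm t b a ^ 2 ≤ ‖a‖ ^ 2 / (frameForm t b b / √(innerMatrix t t).det) := by
  have hσ : 0 < √(innerMatrix t t).det := Real.sqrt_pos.2 ht
  rw [frameRe, frameIm, div_pow, div_pow, ← add_div, frameForm_sq_add_frameCross_sq ht,
    div_div_eq_mul_div, sq (frameForm t b b), mul_div_mul_right _ _ hb.ne']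
  gcongr
  rw [mul_comm]
  exact frameForm_self_le ht a

/-- Together with `inner_one_eq_frame`: the tangential part of `a` expanded in the orthogonal basis
formed by the tangential part of `b` and its rotation. As covectors, `a = frameRe • b + frameIm •
*b`. -/
theorem inner_zero_eq_frame {t : Fin 2 → E} (ht : 0 < (innerMatrix t t).det) {b : E}
    (hb : frameForm t b b ≠ 0) (a : E) :
    inner ℝ (t 0) a =
      frameRe t b a * inner ℝ (t 0) b - frameIm t b a * flux (innerMatrix t t) (fun j => inner ℝ (t j) b) 1 := by
  have sym := flux_symm ht (innerMatrix_symm t) (fun j => inner ℝ (t j) b)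
    (fun j => inner ℝ (t j) a)
  have cross := flux_cross ht (innerMatrix_symm t) (fun j => inner ℝ (t j) b)
    (fun j => inner ℝ (t j) a)
  rw [frameRe, frameIm]
  field_simp
  simp only [frameForm, frameCross, Fin.sum_univ_two]
  linear_combination inner ℝ (t 0) b * sym

theorem inner_one_eq_frame {t : Fin 2 → E} (ht : 0 < (innerMatrix t t).det) {b : E}
    (hb : frameForm t b b ≠ 0) (a : E) :
    inner ℝ (t 1) a =
      frameRe t b a * inner ℝ (t 1) b + frameIm t b a * flux (innerMatrix t t) (fun j => inner ℝ (t j) b) 0 := by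
  have sym := flux_symm ht (innerMatrix_symm t) (fun j => inner ℝ (t j) b)
    (fun j => inner ℝ (t j) a)
  have cross := flux_cross ht (innerMatrix_symm t) (fun j => inner ℝ (t j) b)
    (fun j => inner ℝ (t j) a)
  rw [frameRe, frameIm]
  field_simp
  simp only [frameForm, frameCross, Fin.sum_univ_two]
  linear_combination inner ℝ (t 1) b * sym

/-- Together with `flux_one_eq_frame`: the Hodge star of the preceding expansion, `*a = frameRe • *b
- frameIm • b`. -/
theorem flux_zero_eq_frame {t : Fin 2 → E} (ht : 0 < (innerMatrix t t).det) {b : E}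
    (hb : frameForm t b b ≠ 0) (a : E) :
    flux (innerMatrix t t) (fun j => inner ℝ (t j) a) 0 =
      frameRe t b a * flux (innerMatrix t t) (fun j => inner ℝ (t j) b) 0 - frameIm t b a * inner ℝ (t 1) b := by
  have sym := flux_symm ht (innerMatrix_symm t) (fun j => inner ℝ (t j) b)
    (fun j => inner ℝ (t j) a)
  have cross := flux_cross ht (innerMatrix_symm t) (fun j => inner ℝ (t j) b)
    (fun j => inner ℝ (t j) a)
  rw [frameRe, frameIm]
  field_simp
  simp only [frameForm, frameCross, Fin.sum_univ_two]
  linear_combination -inner ℝ (t 1) b * cross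

theorem flux_one_eq_frame {t : Fin 2 → E} (ht : 0 < (innerMatrix t t).det) {b : E}
    (hb : frameForm t b b ≠ 0) (a : E) :
    flux (innerMatrix t t) (fun j => inner ℝ (t j) a) 1 =
      frameRe t b a * flux (innerMatrix t t) (fun j => inner ℝ (t j) b) 1 + frameIm t b a * inner ℝ (t 0) b := by
  have sym := flux_symm ht (innerMatrix_symm t) (fun j => inner ℝ (t j) b)
    (fun j => inner ℝ (t j) a)
  have cross := flux_cross ht (innerMatrix_symm t) (fun j => inner ℝ (t j) b)
    (fun j => inner ℝ (t j) a)
  rw [frameRe, frameIm]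
  field_simp
  simp only [frameForm, frameCross, Fin.sum_univ_two]
  linear_combination inner ℝ (t 0) b * cross

end Frames

end MinimalSurface

namespace MinimalSurface

open Filter Topology

/-! ### Minimal parametrized surfaces -/

section Parametrized

local notation "ℝ²" => EuclideanSpace ℝ (Fin 2)

variable {E : Type*} [NormedAddCommGroup E] [InnerProductSpace ℝ E]

/-- The coordinate tangent vectors of a parametrized surface. -/
def coordFrame (F : ℝ² → E) (p : ℝ²) (i : Fin 2) : E := fderiv ℝ F p (stdVec i)

/-- The second derivative traced with `det g • g⁻¹`. -/
def hessianTrace (F : ℝ² → E) (p : ℝ²) : E :=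
  (inner ℝ (coordFrame F p 1) (coordFrame F p 1) : ℝ) •
      fderiv ℝ (fderiv ℝ F) p (stdVec 0) (stdVec 0)
    - (inner ℝ (coordFrame F p 0) (coordFrame F p 1) : ℝ) •
      (fderiv ℝ (fderiv ℝ F) p (stdVec 0) (stdVec 1)
        + fderiv ℝ (fderiv ℝ F) p (stdVec 1) (stdVec 0))
    + (inner ℝ (coordFrame F p 0) (coordFrame F p 0) : ℝ) •
      fderiv ℝ (fderiv ℝ F) p (stdVec 1) (stdVec 1)

/-- `F` parametrizes a minimal surface near `p`. -/
structure IsMinimalChart (F : ℝ² → E) (p : ℝ²) : Prop where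
  contDiffAt : ContDiffAt ℝ ∞ F p
  det_pos : 0 < (innerMatrix (coordFrame F p) (coordFrame F p)).det
  minimal : hessianTrace F p ∈ Submodule.span ℝ (Set.range (coordFrame F p))

theorem contDiffAt_coordFrame {F : ℝ² → E} {p : ℝ²} (hF : ContDiffAt ℝ ∞ F p) (i : Fin 2) :
    ContDiffAt ℝ ∞ (fun q => coordFrame F q i) p :=
  (hF.fderiv_right (m := ∞) le_rfl).clm_apply contDiffAt_const

theorem fderiv_coordFrame {F : ℝ² → E} {p : ℝ²} (hF : ContDiffAt ℝ ∞ F p) (i : Fin 2) (v : ℝ²) :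
    fderiv ℝ (fun q => coordFrame F q i) p v = fderiv ℝ (fderiv ℝ F) p v (stdVec i) := by
  have hd : DifferentiableAt ℝ (fderiv ℝ F) p :=
    (hF.fderiv_right (m := ∞) le_rfl).differentiableAt (by simp)
  have : (fun q => coordFrame F q i) = fun q => fderiv ℝ F q (stdVec i) := rfl
  rw [this, fderiv_clm_apply hd (differentiableAt_const _)]
  simp

theorem secondDeriv_symm {F : ℝ² → E} {p : ℝ²} (hF : ContDiffAt ℝ ∞ F p) (v w : ℝ²) :
    fderiv ℝ (fderiv ℝ F) p v w = fderiv ℝ (fderiv ℝ F) p w v :=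
  (hF.isSymmSndFDerivAt (by
    simp only [minSmoothness_of_isRCLikeNormedField]; exact ENat.LEInfty.out)).eq v w

theorem contDiffAt_det_innerMatrix {F : ℝ² → E} {p : ℝ²} (hF : ContDiffAt ℝ ∞ F p) :
    ContDiffAt ℝ ∞ (fun q => (innerMatrix (coordFrame F q) (coordFrame F q)).det) p := by
  have h0 := contDiffAt_coordFrame hF 0
  have h1 := contDiffAt_coordFrame hF 1
  simp only [det_innerMatrix]
  exact ((h0.inner ℝ h0).mul (h1.inner ℝ h1)).sub ((h0.inner ℝ h1).mul (h0.inner ℝ h1))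

theorem contDiffAt_sqrt_det {F : ℝ² → E} {p : ℝ²} (hF : ContDiffAt ℝ ∞ F p)
    (hdet : 0 < (innerMatrix (coordFrame F p) (coordFrame F p)).det) :
    ContDiffAt ℝ ∞ (fun q => √(innerMatrix (coordFrame F q) (coordFrame F q)).det) p :=
  (contDiffAt_det_innerMatrix hF).sqrt hdet.ne'

theorem eventually_det_pos {F : ℝ² → E} {p : ℝ²} (hF : ContDiffAt ℝ ∞ F p)
    (hdet : 0 < (innerMatrix (coordFrame F p) (coordFrame F p)).det) :
    ∀ᶠ q in 𝓝 p, 0 < (innerMatrix (coordFrame F q) (coordFrame F q)).det :=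
  (contDiffAt_det_innerMatrix hF).continuousAt.eventually_const_lt hdet

/-- The flux of the gradient of the `E`-valued coordinate function of a parametrized surface. -/
def fluxVector (F : ℝ² → E) (q : ℝ²) : Fin 2 → E :=
  ![(√(innerMatrix (coordFrame F q) (coordFrame F q)).det)⁻¹ •
      ((inner ℝ (coordFrame F q 1) (coordFrame F q 1) : ℝ) • coordFrame F q 0
        - (inner ℝ (coordFrame F q 0) (coordFrame F q 1) : ℝ) • coordFrame F q 1),
    (√(innerMatrix (coordFrame F q) (coordFrame F q)).det)⁻¹ •
      ((inner ℝ (coordFrame F q 0) (coordFrame F q 0) : ℝ) • coordFrame F q 1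
        - (inner ℝ (coordFrame F q 0) (coordFrame F q 1) : ℝ) • coordFrame F q 0)]

theorem flux_inner_eq {F : ℝ² → E} {q : ℝ²}
    (hdet : 0 < (innerMatrix (coordFrame F q) (coordFrame F q)).det) (e : E) (i : Fin 2) :
    flux (innerMatrix (coordFrame F q) (coordFrame F q)) (fun j => inner ℝ (coordFrame F q j) e) i
      = inner ℝ (fluxVector F q i) e := by
  fin_cases i
  · simp only [Fin.zero_eta, fluxVector, flux_zero hdet, Matrix.cons_val_zero,
      real_inner_smul_left, inner_sub_left]
    simp only [innerMatrix, Matrix.of_apply]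
    ring
  · simp only [Fin.mk_one, fluxVector, flux_one hdet, Matrix.cons_val_one,
      Matrix.cons_val_fin_one, real_inner_smul_left, inner_sub_left, innerMatrix_symm]
    simp only [innerMatrix, Matrix.of_apply]
    ring

theorem contDiffAt_fluxVector {F : ℝ² → E} {p : ℝ²} (hF : ContDiffAt ℝ ∞ F p)
    (hdet : 0 < (innerMatrix (coordFrame F p) (coordFrame F p)).det) (i : Fin 2) :
    ContDiffAt ℝ ∞ (fun q => fluxVector F q i) p := by
  have h0 := contDiffAt_coordFrame hF 0
  have h1 := contDiffAt_coordFrame hF 1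
  have hσ := (contDiffAt_sqrt_det hF hdet).inv (Real.sqrt_pos.2 hdet).ne'
  fin_cases i
  · exact hσ.smul (((h1.inner ℝ h1).smul h0).sub ((h0.inner ℝ h1).smul h1))
  · exact hσ.smul (((h0.inner ℝ h0).smul h1).sub ((h0.inner ℝ h1).smul h0))

theorem eq_zero_of_mem_span_of_inner {ι : Type*} [Fintype ι] {t : ι → E} {z : E}
    (hz : z ∈ Submodule.span ℝ (Set.range t)) (h : ∀ i, inner ℝ (t i) z = 0) : z = 0 := by
  obtain ⟨c, hc⟩ := Submodule.mem_span_range_iff_exists_fun ℝ |>.1 hz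
  rw [← inner_self_eq_zero (𝕜 := ℝ)]
  nth_rewrite 1 [← hc]
  simp [sum_inner, real_inner_smul_left, h]

/-- The coordinate functions of a minimal surface are harmonic. -/
theorem div_fluxVector {F : ℝ² → E} {p : ℝ²} (h : IsMinimalChart F p) :
    fderiv ℝ (fun q => fluxVector F q 0) p (stdVec 0)
      + fderiv ℝ (fun q => fluxVector F q 1) p (stdVec 1) = 0 := by
  have hF := h.contDiffAt
  have hdet := h.det_pos
  have d0 := (contDiffAt_coordFrame hF 0).differentiableAt (by simp)
  have d1 := (contDiffAt_coordFrame hF 1).differentiableAt (by simp)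
  have dσ := (contDiffAt_sqrt_det hF hdet).differentiableAt (by simp)
  have dV0 := (contDiffAt_fluxVector hF hdet 0).differentiableAt (by simp)
  have dV1 := (contDiffAt_fluxVector hF hdet 1).differentiableAt (by simp)
  have hσ : 0 < √(innerMatrix (coordFrame F p) (coordFrame F p)).det := Real.sqrt_pos.2 hdet
  have hev := eventually_det_pos hF hdet
  have hm := h.minimal
  have f0 := fderiv_coordFrame hF 0
  have f1 := fderiv_coordFrame hF 1
  have hsymm := secondDeriv_symm hF (stdVec 1) (stdVec 0)
  -- the derivative of `σ² = det g`
  have eσ : ∀ v, 2 * √(innerMatrix (coordFrame F p) (coordFrame F p)).det *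
      fderiv ℝ (fun q => √(innerMatrix (coordFrame F q) (coordFrame F q)).det) p v
      = fderiv ℝ (fun q => inner ℝ (coordFrame F q 0) (coordFrame F q 0) *
          inner ℝ (coordFrame F q 1) (coordFrame F q 1) -
          inner ℝ (coordFrame F q 0) (coordFrame F q 1) *
          inner ℝ (coordFrame F q 0) (coordFrame F q 1)) p v := by
    intro v
    have : (fun q => (inner ℝ (coordFrame F q 0) (coordFrame F q 0) *
          inner ℝ (coordFrame F q 1) (coordFrame F q 1) -
          inner ℝ (coordFrame F q 0) (coordFrame F q 1) *
          inner ℝ (coordFrame F q 0) (coordFrame F q 1) : ℝ)) =ᶠ[𝓝 p]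
        fun q => √(innerMatrix (coordFrame F q) (coordFrame F q)).det *
          √(innerMatrix (coordFrame F q) (coordFrame F q)).det := by
      filter_upwards [hev] with q hq
      rw [Real.mul_self_sqrt hq.le, det_innerMatrix]
    rw [this.fderiv_eq, fderiv_fun_mul dσ dσ]
    simp only [add_apply, smul_apply, smul_eq_mul]
    ring
  have i00 := d0.inner ℝ d0
  have i01 := d0.inner ℝ d1
  have i11 := d1.inner ℝ d1
  have eσ' : ∀ v, 2 * √(innerMatrix (coordFrame F p) (coordFrame F p)).det *
      fderiv ℝ (fun q => √(innerMatrix (coordFrame F q) (coordFrame F q)).det) p v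
      = 2 * (inner ℝ (coordFrame F p 0) (fderiv ℝ (fderiv ℝ F) p v (stdVec 0)) *
          inner ℝ (coordFrame F p 1) (coordFrame F p 1)
        + inner ℝ (coordFrame F p 0) (coordFrame F p 0) *
          inner ℝ (coordFrame F p 1) (fderiv ℝ (fderiv ℝ F) p v (stdVec 1))
        - inner ℝ (coordFrame F p 0) (coordFrame F p 1) *
          (inner ℝ (coordFrame F p 0) (fderiv ℝ (fderiv ℝ F) p v (stdVec 1))
            + inner ℝ (coordFrame F p 1) (fderiv ℝ (fderiv ℝ F) p v (stdVec 0)))) := by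
    intro v
    rw [eσ, fderiv_fun_sub (i00.fun_mul i11) (i01.fun_mul i01), fderiv_fun_mul i00 i11,
      fderiv_fun_mul i01 i01]
    simp only [sub_apply, add_apply, smul_apply, smul_eq_mul, fderiv_inner_apply ℝ d0 d0,
      fderiv_inner_apply ℝ d0 d1, fderiv_inner_apply ℝ d1 d1, f0, f1,
      real_inner_comm (coordFrame F p 0) (fderiv ℝ (fderiv ℝ F) p v _),
      real_inner_comm (coordFrame F p 1) (fderiv ℝ (fderiv ℝ F) p v _)]
    ring
  -- the derivatives of `σ V`
  have eV0 : √(innerMatrix (coordFrame F p) (coordFrame F p)).det •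
        fderiv ℝ (fun q => fluxVector F q 0) p (stdVec 0)
      + fderiv ℝ (fun q => √(innerMatrix (coordFrame F q) (coordFrame F q)).det) p (stdVec 0) •
        fluxVector F p 0
      = fderiv ℝ (fun q => (inner ℝ (coordFrame F q 1) (coordFrame F q 1) : ℝ) • coordFrame F q 0
        - (inner ℝ (coordFrame F q 0) (coordFrame F q 1) : ℝ) • coordFrame F q 1) p (stdVec 0) := by
    have : (fun q => (inner ℝ (coordFrame F q 1) (coordFrame F q 1) : ℝ) • coordFrame F q 0
        - (inner ℝ (coordFrame F q 0) (coordFrame F q 1) : ℝ) • coordFrame F q 1) =ᶠ[𝓝 p]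
        fun q => √(innerMatrix (coordFrame F q) (coordFrame F q)).det • fluxVector F q 0 := by
      filter_upwards [hev] with q hq
      exact (smul_inv_smul₀ (Real.sqrt_pos.2 hq).ne' _).symm
    rw [this.fderiv_eq, fderiv_fun_smul dσ dV0]
    simp
  have eV1 : √(innerMatrix (coordFrame F p) (coordFrame F p)).det •
        fderiv ℝ (fun q => fluxVector F q 1) p (stdVec 1)
      + fderiv ℝ (fun q => √(innerMatrix (coordFrame F q) (coordFrame F q)).det) p (stdVec 1) •
        fluxVector F p 1
      = fderiv ℝ (fun q => (inner ℝ (coordFrame F q 0) (coordFrame F q 0) : ℝ) • coordFrame F q 1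
        - (inner ℝ (coordFrame F q 0) (coordFrame F q 1) : ℝ) • coordFrame F q 0) p (stdVec 1) := by
    have : (fun q => (inner ℝ (coordFrame F q 0) (coordFrame F q 0) : ℝ) • coordFrame F q 1
        - (inner ℝ (coordFrame F q 0) (coordFrame F q 1) : ℝ) • coordFrame F q 0) =ᶠ[𝓝 p]
        fun q => √(innerMatrix (coordFrame F q) (coordFrame F q)).det • fluxVector F q 1 := by
      filter_upwards [hev] with q hq
      exact (smul_inv_smul₀ (Real.sqrt_pos.2 hq).ne' _).symm
    rw [this.fderiv_eq, fderiv_fun_smul dσ dV1]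
    simp
  rw [fderiv_fun_sub (i11.fun_smul d0) (i01.fun_smul d1), fderiv_fun_smul i11 d0,
    fderiv_fun_smul i01 d1] at eV0
  rw [fderiv_fun_sub (i00.fun_smul d1) (i01.fun_smul d0), fderiv_fun_smul i00 d1,
    fderiv_fun_smul i01 d0] at eV1
  simp only [sub_apply, add_apply, smul_apply, ContinuousLinearMap.smulRight_apply,
    fderiv_inner_apply ℝ d0 d0, fderiv_inner_apply ℝ d0 d1, fderiv_inner_apply ℝ d1 d1, f0, f1]
    at eV0 eV1
  have s0 := eσ' (stdVec 0)
  have s1 := eσ' (stdVec 1)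
  have hσσ := (Real.mul_self_sqrt hdet.le).trans (det_innerMatrix _)
  have w0 : √(innerMatrix (coordFrame F p) (coordFrame F p)).det • fluxVector F p 0 = _ :=
    smul_inv_smul₀ hσ.ne' _
  have w1 : √(innerMatrix (coordFrame F p) (coordFrame F p)).det • fluxVector F p 1 = _ :=
    smul_inv_smul₀ hσ.ne' _
  have hspan0 : coordFrame F p 0 ∈ Submodule.span ℝ (Set.range (coordFrame F p)) :=
    Submodule.subset_span (Set.mem_range_self 0)
  have hspan1 : coordFrame F p 1 ∈ Submodule.span ℝ (Set.range (coordFrame F p)) :=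
    Submodule.subset_span (Set.mem_range_self 1)
  have v0 : fluxVector F p 0 ∈ Submodule.span ℝ (Set.range (coordFrame F p)) :=
    Submodule.smul_mem _ _ (sub_mem (Submodule.smul_mem _ _ hspan0) (Submodule.smul_mem _ _ hspan1))
  have v1 : fluxVector F p 1 ∈ Submodule.span ℝ (Set.range (coordFrame F p)) :=
    Submodule.smul_mem _ _ (sub_mem (Submodule.smul_mem _ _ hspan1) (Submodule.smul_mem _ _ hspan0))
  unfold hessianTrace at hm
  have c01 := real_inner_comm (coordFrame F p 0) (coordFrame F p 1)
  rw [hsymm] at eV1 s1 hm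
  generalize fluxVector F p 0 = V0 at *
  generalize fluxVector F p 1 = V1 at *
  generalize √(innerMatrix (coordFrame F p) (coordFrame F p)).det = σ at *
  generalize fderiv ℝ (fun q => fluxVector F q 0) p (stdVec 0) = Z0 at *
  generalize fderiv ℝ (fun q => fluxVector F q 1) p (stdVec 1) = Z1 at *
  generalize fderiv ℝ (fun q => √(innerMatrix (coordFrame F q) (coordFrame F q)).det) p (stdVec 0)
    = σ0 at *
  generalize fderiv ℝ (fun q => √(innerMatrix (coordFrame F q) (coordFrame F q)).det) p (stdVec 1)
    = σ1 at *
  generalize fderiv ℝ (fderiv ℝ F) p (stdVec 0) (stdVec 0) = H00 at *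
  generalize fderiv ℝ (fderiv ℝ F) p (stdVec 0) (stdVec 1) = H01 at *
  generalize fderiv ℝ (fderiv ℝ F) p (stdVec 1) (stdVec 1) = H11 at *
  clear eσ eσ' hsymm f0 f1 i00 i01 i11 dσ dV0 dV1 d0 d1 hev
  -- The divergence is tangent, because by the product rule `σ` times it differs from `hessianTrace`
  -- by tangent vectors and `hessianTrace` is tangent by minimality. It is also normal, by the
  -- formula for the derivative of `det g`. Hence it vanishes.
  refine eq_zero_of_mem_span_of_inner (t := coordFrame F p) ?_ fun i => ?_
  · have : Z0 + Z1 = σ⁻¹ • (σ • Z0 + σ • Z1) := by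
      rw [← smul_add, inv_smul_smul₀ hσ.ne']
    rw [this]
    refine Submodule.smul_mem _ _ ?_
    rw [eq_sub_of_add_eq eV0, eq_sub_of_add_eq eV1]
    generalize coordFrame F p 0 = t0 at *
    generalize coordFrame F p 1 = t1 at *
    have e := add_mem hm (add_mem
      (Submodule.smul_mem _
        (inner ℝ t1 H01 + inner ℝ H01 t1 - (inner ℝ t0 H11 + inner ℝ H01 t1)) hspan0)
      (sub_mem
        (Submodule.smul_mem _
          (inner ℝ t0 H01 + inner ℝ H01 t0 - (inner ℝ t0 H01 + inner ℝ H00 t1)) hspan1)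
        (add_mem (Submodule.smul_mem _ σ0 v0) (Submodule.smul_mem _ σ1 v1))))
    convert! e using 1
    module
  · apply mul_left_cancel₀ (mul_ne_zero hσ.ne' hσ.ne')
    have a0 := congrArg (fun z => (inner ℝ (coordFrame F p i) z : ℝ)) eV0
    have a1 := congrArg (fun z => (inner ℝ (coordFrame F p i) z : ℝ)) eV1
    have b0 := congrArg (fun z => (inner ℝ (coordFrame F p i) z : ℝ)) w0
    have b1 := congrArg (fun z => (inner ℝ (coordFrame F p i) z : ℝ)) w1
    simp only [inner_add_right, inner_sub_right, real_inner_smul_right] at a0 a1 b0 b1 ⊢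
    simp only [real_inner_comm _ H01, real_inner_comm _ H00] at a0 a1 s0 s1
    fin_cases i
    · simp only [Fin.zero_eta] at *
      linear_combination σ * a0 + σ * a1 - σ0 * b0 - σ1 * b1 + σ0 * hσσ - σ / 2 * s0
    · simp only [Fin.mk_one, c01] at *
      linear_combination σ * a0 + σ * a1 - σ0 * b0 - σ1 * b1 + σ1 * hσσ - σ / 2 * s1

theorem contDiffAt_frameForm {F : ℝ² → E} {p : ℝ²} (hF : ContDiffAt ℝ ∞ F p)
    (hdet : 0 < (innerMatrix (coordFrame F p) (coordFrame F p)).det) (a b : E) :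
    ContDiffAt ℝ ∞ (fun q => frameForm (coordFrame F q) a b) p := by
  have hc : ∀ e : E, ContDiffAt ℝ ∞ (fun _ : ℝ² => e) p := fun e => contDiffAt_const
  have : (fun q => frameForm (coordFrame F q) a b) =ᶠ[𝓝 p]
      fun q => ∑ i, inner ℝ (fluxVector F q i) a * inner ℝ (coordFrame F q i) b := by
    filter_upwards [eventually_det_pos hF hdet] with q hq
    simp only [frameForm, flux_inner_eq hq]
  refine ContDiffAt.congr_of_eventuallyEq ?_ this
  exact ContDiffAt.sum fun i _ => ((contDiffAt_fluxVector hF hdet i).inner ℝ (hc a)).mul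
    ((contDiffAt_coordFrame hF i).inner ℝ (hc b))

theorem contDiffAt_frameRe {F : ℝ² → E} {p : ℝ²} (hF : ContDiffAt ℝ ∞ F p)
    (hdet : 0 < (innerMatrix (coordFrame F p) (coordFrame F p)).det) {b : E}
    (hb : frameForm (coordFrame F p) b b ≠ 0) (a : E) :
    ContDiffAt ℝ ∞ (fun q => frameRe (coordFrame F q) b a) p :=
  (contDiffAt_frameForm hF hdet a b).div (contDiffAt_frameForm hF hdet b b) hb

theorem contDiffAt_frameIm {F : ℝ² → E} {p : ℝ²} (hF : ContDiffAt ℝ ∞ F p)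
    (hdet : 0 < (innerMatrix (coordFrame F p) (coordFrame F p)).det) {b : E}
    (hb : frameForm (coordFrame F p) b b ≠ 0) (a : E) :
    ContDiffAt ℝ ∞ (fun q => frameIm (coordFrame F q) b a) p := by
  have hi : ∀ (i : Fin 2) (e : E), ContDiffAt ℝ ∞ (fun q => (inner ℝ (coordFrame F q i) e : ℝ)) p :=
    fun i e => (contDiffAt_coordFrame hF i).inner ℝ contDiffAt_const
  exact (((hi 0 b).mul (hi 1 a)).sub ((hi 1 b).mul (hi 0 a))).div
    (contDiffAt_frameForm hF hdet b b) hb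

/-- The coordinate functions `⟨F, b⟩` and their conjugates are local isothermal coordinates; in
these, `frameRe` and `frameIm` form a solution of the Cauchy-Riemann equations. -/
theorem cauchyRiemann_frame {F : ℝ² → E} {p : ℝ²} (h : IsMinimalChart F p) {b : E}
    (hb : frameForm (coordFrame F p) b b ≠ 0) (a : E) :
    let g := innerMatrix (coordFrame F p) (coordFrame F p)
    let α := fun j => fderiv ℝ (fun q => frameRe (coordFrame F q) b a) p (stdVec j)
    let β := fun j => fderiv ℝ (fun q => frameIm (coordFrame F q) b a) p (stdVec j)
    (flux g α 0 = -β 1 ∧ flux g α 1 = β 0) ∧ (flux g β 0 = α 1 ∧ flux g β 1 = -α 0) := by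
  intro g α β
  have hF := h.contDiffAt
  have hdet := h.det_pos
  have d0 := (contDiffAt_coordFrame hF 0).differentiableAt (by simp)
  have d1 := (contDiffAt_coordFrame hF 1).differentiableAt (by simp)
  have dV0 := (contDiffAt_fluxVector hF hdet 0).differentiableAt (by simp)
  have dV1 := (contDiffAt_fluxVector hF hdet 1).differentiableAt (by simp)
  have hc : ∀ e : E, DifferentiableAt ℝ (fun _ : ℝ² => e) p := fun e => differentiableAt_const e
  have hdα := (contDiffAt_frameRe hF hdet hb a).differentiableAt (by simp)
  have hdβ := (contDiffAt_frameIm hF hdet hb a).differentiableAt (by simp)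
  have hev := (eventually_det_pos hF hdet).and
    ((contDiffAt_frameForm hF hdet b b).continuousAt.eventually_ne hb)
  have closed : ∀ e : E, fderiv ℝ (fun q => (inner ℝ (coordFrame F q 1) e : ℝ)) p (stdVec 0)
      = fderiv ℝ (fun q => (inner ℝ (coordFrame F q 0) e : ℝ)) p (stdVec 1) := by
    intro e
    rw [fderiv_inner_apply ℝ d1 (hc e), fderiv_inner_apply ℝ d0 (hc e), fderiv_coordFrame hF,
      fderiv_coordFrame hF, secondDeriv_symm hF]
    simp
  have div : ∀ e : E, fderiv ℝ (fun q => (inner ℝ (fluxVector F q 0) e : ℝ)) p (stdVec 0)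
      + fderiv ℝ (fun q => (inner ℝ (fluxVector F q 1) e : ℝ)) p (stdVec 1) = 0 := by
    intro e
    rw [fderiv_inner_apply ℝ dV0 (hc e), fderiv_inner_apply ℝ dV1 (hc e)]
    have := congrArg (fun z => (inner ℝ z e : ℝ)) (div_fluxVector h)
    simpa [inner_add_left] using this
  -- Here `θ = d⟨F, b⟩`. Closedness of the differentials is symmetry of second derivatives;
  -- closedness of their duals is harmonicity of the coordinate functions.
  obtain ⟨h1, h2⟩ := cauchyRiemann_of_closed (p := p)
    (d0.inner ℝ (hc b)) (d1.inner ℝ (hc b)) (dV0.inner ℝ (hc b)) (dV1.inner ℝ (hc b)) hdα hdβ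
    (a₀ := fun q => inner ℝ (coordFrame F q 0) a) (a₁ := fun q => inner ℝ (coordFrame F q 1) a)
    (A₀ := fun q => inner ℝ (fluxVector F q 0) a) (A₁ := fun q => inner ℝ (fluxVector F q 1) a)
    (by
      filter_upwards [hev] with q hq
      simpa only [flux_inner_eq hq.1] using inner_zero_eq_frame hq.1 hq.2 a)
    (by
      filter_upwards [hev] with q hq
      simpa only [flux_inner_eq hq.1] using inner_one_eq_frame hq.1 hq.2 a)
    (by
      filter_upwards [hev] with q hq
      simpa only [flux_inner_eq hq.1] using flux_zero_eq_frame hq.1 hq.2 a)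
    (by
      filter_upwards [hev] with q hq
      simpa only [flux_inner_eq hq.1] using flux_one_eq_frame hq.1 hq.2 a)
    (closed b) (closed a) (div b) (div a)
  refine flux_eq_of_cauchyRiemann (θ := fun j => inner ℝ (coordFrame F p j) b) hdet
    (innerMatrix_symm _) ?_ ?_ ?_
  · simpa [frameForm, Fin.sum_univ_two] using hb
  · simpa only [g, flux_inner_eq hdet] using h1
  · simpa only [g, flux_inner_eq hdet] using h2

/-- By the Cauchy-Riemann equations the flux of `frameRe` is the rotated gradient of `frameIm`,
which is divergence free. -/
theorem laplacian_frameRe {F : ℝ² → E} {p : ℝ²} (h : ∀ᶠ q in 𝓝 p, IsMinimalChart F q) {b : E}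
    (hb : frameForm (coordFrame F p) b b ≠ 0) (a : E) :
    ∑ i, fderiv ℝ (fun q => flux (innerMatrix (coordFrame F q) (coordFrame F q))
      (fun j => fderiv ℝ (fun q => frameRe (coordFrame F q) b a) q (stdVec j)) i) p (stdVec i)
      = 0 := by
  have h0 := h.self_of_nhds
  have hev := h.and
    ((contDiffAt_frameForm h0.contDiffAt h0.det_pos b b).continuousAt.eventually_ne hb)
  rw [Fin.sum_univ_two]
  refine div_conjugate_gradient (contDiffAt_frameIm h0.contDiffAt h0.det_pos hb a) ?_ ?_
  · filter_upwards [hev] with q hq using (cauchyRiemann_frame hq.1 hq.2 a).1.1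
  · filter_upwards [hev] with q hq using (cauchyRiemann_frame hq.1 hq.2 a).1.2

theorem laplacian_frameIm {F : ℝ² → E} {p : ℝ²} (h : ∀ᶠ q in 𝓝 p, IsMinimalChart F q) {b : E}
    (hb : frameForm (coordFrame F p) b b ≠ 0) (a : E) :
    ∑ i, fderiv ℝ (fun q => flux (innerMatrix (coordFrame F q) (coordFrame F q))
      (fun j => fderiv ℝ (fun q => frameIm (coordFrame F q) b a) q (stdVec j)) i) p (stdVec i)
      = 0 := by
  have h0 := h.self_of_nhds
  have hev := h.and
    ((contDiffAt_frameForm h0.contDiffAt h0.det_pos b b).continuousAt.eventually_ne hb)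
  rw [Fin.sum_univ_two]
  -- The conjugate of `frameIm` is `-frameRe`.
  refine div_conjugate_gradient (b := fun q => -frameRe (coordFrame F q) b a)
    (contDiffAt_frameRe h0.contDiffAt h0.det_pos hb a).neg ?_ ?_
  · filter_upwards [hev] with q hq
    rw [fderiv_fun_neg, (cauchyRiemann_frame hq.1 hq.2 a).2.1]
    simp
  · filter_upwards [hev] with q hq
    rw [fderiv_fun_neg, (cauchyRiemann_frame hq.1 hq.2 a).2.2]
    simp

end Parametrized

end MinimalSurface

namespace MinimalSurface

open Filter Topology

/-! ### Invariance under changes of coordinates -/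

section Reparametrization

local notation "ℝ²" => EuclideanSpace ℝ (Fin 2)

variable {E : Type*} [NormedAddCommGroup E] [InnerProductSpace ℝ E]

/-- The transposed Jacobian matrix of a map of the plane. -/
def jacobian (τ : ℝ² → ℝ²) (p : ℝ²) : Matrix (Fin 2) (Fin 2) ℝ :=
  Matrix.of fun i j => fderiv ℝ τ p (stdVec i) j

theorem eq_sum_stdVec (v : ℝ²) : v = v 0 • stdVec 0 + v 1 • stdVec 1 := by
  ext i
  fin_cases i <;> simp [stdVec]

theorem fderiv_stdVec_eq (τ : ℝ² → ℝ²) (p : ℝ²) (i : Fin 2) : fderiv ℝ τ p (stdVec i) =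
    jacobian τ p i 0 • stdVec 0 + jacobian τ p i 1 • stdVec 1 :=
  eq_sum_stdVec _

theorem det_jacobian (τ : ℝ² → ℝ²) (p : ℝ²) : (jacobian τ p).det = (fderiv ℝ τ p).det := by
  rw [ContinuousLinearMap.det, ← LinearMap.det_toMatrix (EuclideanSpace.basisFun (Fin 2) ℝ).toBasis,
    ← Matrix.det_transpose]
  congr 1

theorem coordFrame_comp {F G : ℝ² → E} {τ : ℝ² → ℝ²} {p : ℝ²} (h : F =ᶠ[𝓝 p] G ∘ τ)
    (hG : DifferentiableAt ℝ G (τ p)) (hτ : DifferentiableAt ℝ τ p) :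
    coordFrame F p = changeFrame (jacobian τ p) (coordFrame G (τ p)) := by
  funext i
  rw [coordFrame, h.fderiv_eq, fderiv_comp p hG hτ, ContinuousLinearMap.comp_apply,
    fderiv_stdVec_eq]
  simp [changeFrame, coordFrame, Fin.sum_univ_two]

theorem secondDeriv_comp {F G : ℝ² → E} {τ : ℝ² → ℝ²} {p : ℝ²} (h : F =ᶠ[𝓝 p] G ∘ τ)
    (hG : ContDiffAt ℝ ∞ G (τ p)) (hτ : ContDiffAt ℝ ∞ τ p) (v w : ℝ²) :
    fderiv ℝ (fderiv ℝ F) p v w = fderiv ℝ (fderiv ℝ G) (τ p) (fderiv ℝ τ p v) (fderiv ℝ τ p w)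
      + fderiv ℝ G (τ p) (fderiv ℝ (fderiv ℝ τ) p v w) := by
  have e : fderiv ℝ F =ᶠ[𝓝 p] fun q => (fderiv ℝ G (τ q)).comp (fderiv ℝ τ q) := by
    have h1 : ∀ᶠ q in 𝓝 p, ContDiffAt ℝ 1 τ q :=
      (hτ.of_le ENat.LEInfty.out).eventually (by simp)
    have h2 : ∀ᶠ q in 𝓝 (τ p), ContDiffAt ℝ 1 G q :=
      (hG.of_le ENat.LEInfty.out).eventually (by simp)
    filter_upwards [h.eventuallyEq_nhds, h1, hτ.continuousAt.eventually h2] with q hq hq1 hq2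
    rw [hq.fderiv_eq, fderiv_comp q (hq2.differentiableAt (by simp))
      (hq1.differentiableAt (by simp))]
  have dG : DifferentiableAt ℝ (fderiv ℝ G) (τ p) :=
    (hG.fderiv_right (m := ∞) le_rfl).differentiableAt (by simp)
  have dτ : DifferentiableAt ℝ (fderiv ℝ τ) p :=
    (hτ.fderiv_right (m := ∞) le_rfl).differentiableAt (by simp)
  have d := hτ.differentiableAt (by simp)
  have dc : DifferentiableAt ℝ (fun q => fderiv ℝ G (τ q)) p := dG.comp p d
  have hc : fderiv ℝ (fun q => fderiv ℝ G (τ q)) p = (fderiv ℝ (fderiv ℝ G) (τ p)).comp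
      (fderiv ℝ τ p) := fderiv_comp p dG d
  rw [e.fderiv_eq, fderiv_clm_comp dc dτ, hc]
  simp [add_comm]

/-- Minimality does not depend on the parametrization. -/
theorem IsMinimalChart.comp {F G : ℝ² → E} {τ : ℝ² → ℝ²} {p : ℝ²} (h : F =ᶠ[𝓝 p] G ∘ τ)
    (hG : IsMinimalChart G (τ p)) (hτ : ContDiffAt ℝ ∞ τ p) (hdet : (jacobian τ p).det ≠ 0) :
    IsMinimalChart F p := by
  have hfr := coordFrame_comp h (hG.contDiffAt.differentiableAt (by simp))
    (hτ.differentiableAt (by simp))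
  refine ⟨(hG.contDiffAt.comp p hτ).congr_of_eventuallyEq h, ?_, ?_⟩
  · rw [hfr, innerMatrix_changeFrame, Matrix.det_mul, Matrix.det_mul, Matrix.det_transpose]
    have := hG.det_pos
    have h2 : 0 < (jacobian τ p).det * (jacobian τ p).det := mul_self_pos.2 hdet
    nlinarith [mul_pos h2 this]
  have hspan : Submodule.span ℝ (Set.range (coordFrame F p))
      = Submodule.span ℝ (Set.range (coordFrame G (τ p))) := by
    apply le_antisymm
    · rw [hfr]
      exact OrientedGrassmannian.span_changeFrame_le _ _
    · have : coordFrame G (τ p) = changeFrame (jacobian τ p)⁻¹ (coordFrame F p) := by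
        rw [hfr, ← changeFrame_mul, Matrix.nonsing_inv_mul _ hdet.isUnit, changeFrame_one]
      rw [this]
      exact OrientedGrassmannian.span_changeFrame_le _ _
  rw [hspan]
  have htan : ∀ v, fderiv ℝ G (τ p) v ∈ Submodule.span ℝ (Set.range (coordFrame G (τ p))) := by
    intro v
    rw [eq_sum_stdVec v, map_add, map_smul, map_smul]
    exact add_mem (Submodule.smul_mem _ _ (Submodule.subset_span ⟨0, rfl⟩))
      (Submodule.smul_mem _ _ (Submodule.subset_span ⟨1, rfl⟩))
  have hm := hG.minimal
  have hs := secondDeriv_symm hG.contDiffAt (stdVec 1) (stdVec 0)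
  unfold hessianTrace at hm ⊢
  have f0 : coordFrame F p 0 = jacobian τ p 0 0 • coordFrame G (τ p) 0
      + jacobian τ p 0 1 • coordFrame G (τ p) 1 := by
    rw [hfr]; simp [changeFrame, Fin.sum_univ_two]
  have f1 : coordFrame F p 1 = jacobian τ p 1 0 • coordFrame G (τ p) 0
      + jacobian τ p 1 1 • coordFrame G (τ p) 1 := by
    rw [hfr]; simp [changeFrame, Fin.sum_univ_two]
  simp only [secondDeriv_comp h hG.contDiffAt hτ, fderiv_stdVec_eq]
  have m00 := htan (fderiv ℝ (fderiv ℝ τ) p (stdVec 0) (stdVec 0))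
  have m01 := htan (fderiv ℝ (fderiv ℝ τ) p (stdVec 0) (stdVec 1))
  have m10 := htan (fderiv ℝ (fderiv ℝ τ) p (stdVec 1) (stdVec 0))
  have m11 := htan (fderiv ℝ (fderiv ℝ τ) p (stdVec 1) (stdVec 1))
  -- The adjugate of the metric transforms so that `hessianTrace` picks up the factor `(det J)²`;
  -- the remaining terms contain second derivatives of `τ` and are tangent.
  have key := add_mem (Submodule.smul_mem _ ((jacobian τ p).det ^ 2) hm)
    (add_mem (sub_mem (Submodule.smul_mem _ (inner ℝ (coordFrame F p 1) (coordFrame F p 1)) m00)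
      (Submodule.smul_mem _ (inner ℝ (coordFrame F p 0) (coordFrame F p 1)) (add_mem m01 m10)))
      (Submodule.smul_mem _ (inner ℝ (coordFrame F p 0) (coordFrame F p 0)) m11))
  convert! key using 1
  simp only [map_add, map_smul, add_apply, smul_apply, hs, Matrix.det_fin_two, f0, f1,
    inner_add_left, inner_add_right, real_inner_smul_left, real_inner_smul_right,
    real_inner_comm (coordFrame G (τ p) 0) (coordFrame G (τ p) 1)]
  module

end Reparametrization

end MinimalSurface

namespace MinimalSurface

open Filter Topology

/-! ### Minimal immersed surfaces -/

section Surface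

set_option linter.unusedSectionVars false

local notation "ℝ²" => EuclideanSpace ℝ (Fin 2)

variable {E : Type*} [NormedAddCommGroup E] [InnerProductSpace ℝ E]
variable {M : Type*} [TopologicalSpace M] [ChartedSpace (EuclideanSpace ℝ (Fin 2)) M]
  [IsManifold (𝓡 2) ∞ M]

theorem contDiffAt_comp_chart_symm {f : M → E} (hf : ContMDiff (𝓡 2) 𝓘(ℝ, E) ∞ f) (x : M) {q : ℝ²}
    (hq : q ∈ (chart x).target) : ContDiffAt ℝ ∞ (f ∘ (chart x).symm) q := by
  rw [← contMDiffAt_iff_contDiffAt]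
  exact (hf _).comp q
    ((contMDiffOn_chart_symm (I := 𝓡 2) (n := ∞)).contMDiffAt ((chart x).open_target.mem_nhds hq))

theorem contDiffAt_transition {x y : M} (hy : y ∈ (chart (n := 2) x).source) :
    ContDiffAt ℝ ∞ (chart (n := 2) y ∘ (chart (n := 2) x).symm) (chart (n := 2) x y) := by
  rw [← contMDiffAt_iff_contDiffAt]
  have h1 : ContMDiffAt (𝓡 2) (𝓡 2) ∞ (chart (n := 2) x).symm (chart x y) :=
    (contMDiffOn_chart_symm (I := 𝓡 2) (n := ∞)).contMDiffAt
      ((chart x).open_target.mem_nhds ((chart x).map_source hy))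
  refine ContMDiffAt.comp (I' := 𝓡 2) (chart x y) ?_ h1
  rw [(chart x).left_inv hy]
  exact contMDiffAt_of_mem_maximalAtlas (IsManifold.chart_mem_maximalAtlas y) (mem_chart_source ℝ² y)

theorem eventuallyEq_comp_transition (f : M → E) {x y : M} (hy : y ∈ (chart (n := 2) x).source) :
    f ∘ (chart (n := 2) x).symm =ᶠ[𝓝 (chart x y)]
      (f ∘ (chart (n := 2) y).symm) ∘ (chart (n := 2) y ∘ (chart x).symm) := by
  have hc : ContinuousAt (chart (n := 2) x).symm (chart x y) :=
    (chart x).continuousAt_symm ((chart x).map_source hy)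
  have : (chart (n := 2) y).source ∈ 𝓝 ((chart (n := 2) x).symm (chart x y)) := by
    rw [(chart x).left_inv hy]
    exact chart_source_mem_nhds _ y
  filter_upwards [hc this] with q hq
  simp only [Function.comp_apply]
  rw [(chart y).left_inv hq]

theorem det_jacobian_transition_pos (hor : IsOrientedAtlas 2 M) {x y : M}
    (hy : y ∈ (chart (n := 2) x).source) :
    0 < (jacobian (chart (n := 2) y ∘ (chart x).symm) (chart x y)).det := by
  rw [det_jacobian]
  have := hor (chart x) (chart_mem_atlas _ x) (chart y) (chart_mem_atlas _ y) (chart x y) (by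
    rw [OpenPartialHomeomorph.trans_source]
    refine ⟨(chart x).map_source hy, ?_⟩
    rw [Set.mem_preimage, (chart x).left_inv hy]
    exact mem_chart_source _ y)
  simpa using this

variable [RiemannianBundle (fun x : M => TangentSpace (𝓡 2) x)]

theorem coordFrame_chart (f : M → E) (x : M) :
    coordFrame (f ∘ (chart (n := 2) x).symm) (chart x x) = tangentFrame (n := 2) f x := rfl

theorem coordMetric_eq {f : M → E} (hf : IsIsometricImmersion (n := 2) f) (x : M) {q : ℝ²}
    (hq : q ∈ (chart x).target) :
    coordMetric x q = innerMatrix (coordFrame (f ∘ (chart (n := 2) x).symm) q)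
      (coordFrame (f ∘ (chart (n := 2) x).symm) q) := by
  have h1 : MDifferentiableAt (𝓡 2) (𝓡 2) (chart (n := 2) x).symm q :=
    ((contMDiffOn_chart_symm (I := 𝓡 2) (n := ∞)).contMDiffAt
      ((chart x).open_target.mem_nhds hq)).mdifferentiableAt (by simp)
  have h2 : MDifferentiableAt (𝓡 2) 𝓘(ℝ, E) f ((chart (n := 2) x).symm q) :=
    (hf.contMDiff _).mdifferentiableAt (by simp)
  have h3 : ∀ i, coordFrame (f ∘ (chart (n := 2) x).symm) q i =
      mfderiv (𝓡 2) 𝓘(ℝ, E) f ((chart (n := 2) x).symm q) (coordVector x q i) := by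
    intro i
    rw [coordFrame, ← mfderiv_eq_fderiv, mfderiv_comp q h2 h1]
    rfl
  ext i j
  rw [coordMetric, Matrix.of_apply, innerMatrix, Matrix.of_apply, h3, h3]
  exact (hf.inner_mfderiv _ _ _).symm

theorem det_innerMatrix_tangentFrame_pos {f : M → E} (hf : IsIsometricImmersion (n := 2) f) (x : M) :
    0 < (innerMatrix (tangentFrame (n := 2) f x) (tangentFrame (n := 2) f x)).det :=
  det_innerMatrix_pos (linearIndependent_tangentFrame hf x)

theorem isMinimalChart_self {f : M → E} (hf : IsIsometricImmersion (n := 2) f)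
    (hmin : IsMinimal (n := 2) f) (x : M) :
    IsMinimalChart (f ∘ (chart (n := 2) x).symm) (chart x x) := by
  have hdet := det_innerMatrix_tangentFrame_pos hf x
  refine ⟨contDiffAt_comp_chart_symm hf.contMDiff x (mem_chart_target _ x), hdet, ?_⟩
  have h := hmin x
  rw [meanCurvature, coordMetric_eq hf x (mem_chart_target _ x), coordFrame_chart] at h
  simp only [secondFundamentalForm, ← map_smul, ← map_sum] at h
  -- Multiplying by `det g` replaces `g⁻¹` by the adjugate. A vector with zero normal projection
  -- lies in the double orthogonal complement of the tangent plane, which is the plane itself.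
  have h' := congrArg (fun z => (innerMatrix (tangentFrame (n := 2) f x)
    (tangentFrame (n := 2) f x)).det • z) h
  simp only [smul_zero, ← map_smul] at h'
  rw [Submodule.starProjection_apply_eq_zero_iff, Submodule.orthogonal_orthogonal] at h'
  have hspan : tangentPlane (n := 2) f x =
    Submodule.span ℝ (Set.range (coordFrame (f ∘ (chart (n := 2) x).symm) (chart x x))) := rfl
  rw [← hspan]
  convert! h' using 1
  have hne := hdet.ne'
  simp only [Fin.sum_univ_two, map_add, map_smul, hessianTrace, Matrix.inv_def, Ring.inverse_eq_inv',
    Matrix.adjugate_fin_two, Matrix.smul_apply, Matrix.of_apply, Matrix.cons_val',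
    Matrix.cons_val_zero, Matrix.cons_val_one, Matrix.cons_val_fin_one, smul_eq_mul, smul_add,
    smul_smul, mul_inv_cancel_left₀ hne, innerMatrix_symm, coordFrame_chart]
  simp only [innerMatrix, Matrix.of_apply]
  module

/-- Mean curvature at `y` is computed in the preferred chart of `y`, whereas harmonicity near `x`
needs minimality at all points of one chart. The coordinate change carries it over. -/
theorem isMinimalChart {f : M → E} (hf : IsIsometricImmersion (n := 2) f)
    (hmin : IsMinimal (n := 2) f) (hor : IsOrientedAtlas 2 M) (x : M) {q : ℝ²}
    (hq : q ∈ (chart x).target) : IsMinimalChart (f ∘ (chart (n := 2) x).symm) q := by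
  obtain ⟨y, hy, rfl⟩ : ∃ y ∈ (chart (n := 2) x).source, chart x y = q :=
    ⟨(chart x).symm q, (chart x).map_target hq, (chart x).right_inv hq⟩
  refine IsMinimalChart.comp (eventuallyEq_comp_transition f hy) ?_ (contDiffAt_transition hy)
    (det_jacobian_transition_pos hor hy).ne'
  rw [Function.comp_apply, (chart x).left_inv hy]
  exact isMinimalChart_self hf hmin y

theorem tangentFrame_changeFrame {f : M → E} (hf : ContMDiff (𝓡 2) 𝓘(ℝ, E) ∞ f) {x y : M}
    (hy : y ∈ (chart (n := 2) x).source) :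
    coordFrame (f ∘ (chart (n := 2) x).symm) (chart x y) =
      changeFrame (jacobian (chart (n := 2) y ∘ (chart x).symm) (chart x y))
        (tangentFrame (n := 2) f y) := by
  have h : (chart (n := 2) y ∘ (chart (n := 2) x).symm) (chart x y) = chart y y := by
    rw [Function.comp_apply, (chart x).left_inv hy]
  rw [coordFrame_comp (eventuallyEq_comp_transition f hy)
    (by rw [h]; exact (contDiffAt_comp_chart_symm hf y (mem_chart_target _ y)).differentiableAt
          (by simp))
    ((contDiffAt_transition hy).differentiableAt (by simp)), h, coordFrame_chart]

/-- The function `⟨a', b'⟩ / |b'|²` of the tangential parts of two fixed vectors. -/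
def tangentRe (f : M → E) (b a : E) (x : M) : ℝ := frameRe (tangentFrame (n := 2) f x) b a

/-- The function `⟨a', J b'⟩ / |b'|²` of the tangential parts of two fixed vectors. -/
def tangentIm (f : M → E) (b a : E) (x : M) : ℝ := frameIm (tangentFrame (n := 2) f x) b a

theorem tangentRe_comp_chart_symm {f : M → E} (hf : IsIsometricImmersion (n := 2) f)
    (hor : IsOrientedAtlas 2 M) (b a : E) (x : M) {q : ℝ²} (hq : q ∈ (chart x).target) :
    tangentRe f b a ((chart x).symm q) =
      frameRe (coordFrame (f ∘ (chart (n := 2) x).symm) q) b a := by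
  obtain ⟨y, hy, rfl⟩ : ∃ y ∈ (chart (n := 2) x).source, chart x y = q :=
    ⟨(chart x).symm q, (chart x).map_target hq, (chart x).right_inv hq⟩
  rw [tangentFrame_changeFrame hf.contMDiff hy, (chart x).left_inv hy,
    frameRe_changeFrame (det_jacobian_transition_pos hor hy)
      (det_innerMatrix_tangentFrame_pos hf y)]
  rfl

/-- The value at each point is defined by that point's own chart. `frameIm` changes sign with the
orientation, so positivity of the Jacobian determinants is what makes it agree across charts. -/
theorem tangentIm_comp_chart_symm {f : M → E} (hf : IsIsometricImmersion (n := 2) f)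
    (hor : IsOrientedAtlas 2 M) (b a : E) (x : M) {q : ℝ²} (hq : q ∈ (chart x).target) :
    tangentIm f b a ((chart x).symm q) =
      frameIm (coordFrame (f ∘ (chart (n := 2) x).symm) q) b a := by
  obtain ⟨y, hy, rfl⟩ : ∃ y ∈ (chart (n := 2) x).source, chart x y = q :=
    ⟨(chart x).symm q, (chart x).map_target hq, (chart x).right_inv hq⟩
  rw [tangentFrame_changeFrame hf.contMDiff hy, (chart x).left_inv hy,
    frameIm_changeFrame (det_jacobian_transition_pos hor hy)
      (det_innerMatrix_tangentFrame_pos hf y)]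
  rfl

theorem contMDiff_of_comp_chart_symm {u : M → ℝ}
    (h : ∀ x : M, ContDiffAt ℝ ∞ (u ∘ (chart (n := 2) x).symm) (chart x x)) :
    ContMDiff (𝓡 2) 𝓘(ℝ, ℝ) ∞ u := by
  intro x
  have h1 : ContMDiffAt (𝓡 2) (𝓡 2) ∞ (chart (n := 2) x) x :=
    contMDiffAt_of_mem_maximalAtlas (IsManifold.chart_mem_maximalAtlas x) (mem_chart_source ℝ² x)
  refine (ContMDiffAt.comp x (contMDiffAt_iff_contDiffAt.2 (h x)) h1).congr_of_eventuallyEq ?_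
  filter_upwards [chart_source_mem_nhds ℝ² x] with y hy
  simp only [Function.comp_apply]
  rw [(chart x).left_inv hy]

theorem laplaceBeltrami_eq_zero {f : M → E} (hf : IsIsometricImmersion (n := 2) f) {u : M → ℝ}
    {x : M} {U : ℝ² → ℝ} (hU : ∀ q ∈ (chart (n := 2) x).target, u ((chart x).symm q) = U q)
    (h : ∑ i, fderiv ℝ (fun q => flux (innerMatrix (coordFrame (f ∘ (chart (n := 2) x).symm) q)
      (coordFrame (f ∘ (chart (n := 2) x).symm) q))
      (fun j => fderiv ℝ U q (stdVec j)) i) (chart x x) (stdVec i) = 0) :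
    laplaceBeltrami 2 u x = 0 := by
  rw [laplaceBeltrami]
  convert! mul_zero _
  rw [← h]
  refine Finset.sum_congr rfl fun i _ => ?_
  congr 1
  apply Filter.EventuallyEq.fderiv_eq
  have ht : (chart (n := 2) x).target ∈ 𝓝 (chart x x) := chart_target_mem_nhds _ x
  filter_upwards [ht] with q hq
  have e : u ∘ (chart x).symm =ᶠ[𝓝 q] U := by
    filter_upwards [(chart x).open_target.mem_nhds hq] with z hz using hU z hz
  simp only [flux, coordMetric_eq hf x hq, e.fderiv_eq]

theorem contMDiff_tangentRe {f : M → E} (hf : IsIsometricImmersion (n := 2) f)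
    (hor : IsOrientedAtlas 2 M) {b : E}
    (hb : ∀ x, frameForm (tangentFrame (n := 2) f x) b b ≠ 0) (a : E) :
    ContMDiff (𝓡 2) 𝓘(ℝ, ℝ) ∞ (tangentRe f b a) := by
  refine contMDiff_of_comp_chart_symm fun x => ?_
  refine (contDiffAt_frameRe (contDiffAt_comp_chart_symm hf.contMDiff x (mem_chart_target _ x))
    (det_innerMatrix_tangentFrame_pos hf x) (hb x) a).congr_of_eventuallyEq ?_
  have ht : (chart (n := 2) x).target ∈ 𝓝 (chart x x) := chart_target_mem_nhds _ x
  filter_upwards [ht] with q hq using tangentRe_comp_chart_symm hf hor b a x hq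

theorem contMDiff_tangentIm {f : M → E} (hf : IsIsometricImmersion (n := 2) f)
    (hor : IsOrientedAtlas 2 M) {b : E}
    (hb : ∀ x, frameForm (tangentFrame (n := 2) f x) b b ≠ 0) (a : E) :
    ContMDiff (𝓡 2) 𝓘(ℝ, ℝ) ∞ (tangentIm f b a) := by
  refine contMDiff_of_comp_chart_symm fun x => ?_
  refine (contDiffAt_frameIm (contDiffAt_comp_chart_symm hf.contMDiff x (mem_chart_target _ x))
    (det_innerMatrix_tangentFrame_pos hf x) (hb x) a).congr_of_eventuallyEq ?_
  have ht : (chart (n := 2) x).target ∈ 𝓝 (chart x x) := chart_target_mem_nhds _ x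
  filter_upwards [ht] with q hq using tangentIm_comp_chart_symm hf hor b a x hq

theorem eventually_isMinimalChart {f : M → E} (hf : IsIsometricImmersion (n := 2) f)
    (hmin : IsMinimal (n := 2) f) (hor : IsOrientedAtlas 2 M) (x : M) :
    ∀ᶠ q in 𝓝 (chart (n := 2) x x), IsMinimalChart (f ∘ (chart (n := 2) x).symm) q := by
  have ht : (chart (n := 2) x).target ∈ 𝓝 (chart x x) := chart_target_mem_nhds _ x
  filter_upwards [ht] with q hq using isMinimalChart hf hmin hor x hq

theorem laplaceBeltrami_tangentRe {f : M → E} (hf : IsIsometricImmersion (n := 2) f)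
    (hmin : IsMinimal (n := 2) f) (hor : IsOrientedAtlas 2 M) {b : E}
    (hb : ∀ x, frameForm (tangentFrame (n := 2) f x) b b ≠ 0) (a : E) (x : M) :
    laplaceBeltrami 2 (tangentRe f b a) x = 0 :=
  laplaceBeltrami_eq_zero hf (fun _ hq => tangentRe_comp_chart_symm hf hor b a x hq)
    (laplacian_frameRe (eventually_isMinimalChart hf hmin hor x) (hb x) a)

theorem laplaceBeltrami_tangentIm {f : M → E} (hf : IsIsometricImmersion (n := 2) f)
    (hmin : IsMinimal (n := 2) f) (hor : IsOrientedAtlas 2 M) {b : E}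
    (hb : ∀ x, frameForm (tangentFrame (n := 2) f x) b b ≠ 0) (a : E) (x : M) :
    laplaceBeltrami 2 (tangentIm f b a) x = 0 :=
  laplaceBeltrami_eq_zero hf (fun _ hq => tangentIm_comp_chart_symm hf hor b a x hq)
    (laplacian_frameIm (eventually_isMinimalChart hf hmin hor x) (hb x) a)

end Surface

end MinimalSurface

namespace MinimalSurface

open Filter Topology

/-! ### Bounds on the Grassmannian -/

namespace OrientedGrassmannian

variable {E : Type*} [NormedAddCommGroup E] [InnerProductSpace ℝ E]

/-- The squared length of the orthogonal projection of `b` to an oriented plane. -/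
def projSq (b : E) (S : OrientedGrassmannian 2 E) : ℝ :=
  Quotient.lift (fun t : Frame 2 E => frameForm t.1 b b / √(innerMatrix t.1 t.1).det) (by
    rintro t u ⟨A, hA, h⟩
    have hu := det_innerMatrix_pos u.2
    have e : (innerMatrix (changeFrame A u.1) (changeFrame A u.1)).det
        = A.det ^ 2 * (innerMatrix u.1 u.1).det := by
      rw [innerMatrix_changeFrame, Matrix.det_mul, Matrix.det_mul, Matrix.det_transpose]
      ring
    simp only [h]
    rw [frameForm_changeFrame hA hu, e, Real.sqrt_mul (sq_nonneg _), Real.sqrt_sq hA.le,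
      mul_div_mul_left _ _ hA.ne']) S

theorem continuous_projSq (b : E) : Continuous (projSq b) := by
  refine Continuous.quotient_lift ?_ _
  have h0 : Continuous fun t : Frame 2 E => t.1 0 := (continuous_apply 0).comp continuous_subtype_val
  have h1 : Continuous fun t : Frame 2 E => t.1 1 := (continuous_apply 1).comp continuous_subtype_val
  have i00 := Continuous.inner (𝕜 := ℝ) h0 h0
  have i01 := Continuous.inner (𝕜 := ℝ) h0 h1
  have i11 := Continuous.inner (𝕜 := ℝ) h1 h1
  have i0b := Continuous.inner (𝕜 := ℝ) h0 (continuous_const (y := b))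
  have i1b := Continuous.inner (𝕜 := ℝ) h1 (continuous_const (y := b))
  have hdet : Continuous fun t : Frame 2 E => √(innerMatrix t.1 t.1).det := by
    simp only [det_innerMatrix]
    exact ((i00.mul i11).sub (i01.mul i01)).sqrt
  have hne : ∀ t : Frame 2 E, √(innerMatrix t.1 t.1).det ≠ 0 := fun t =>
    (Real.sqrt_pos.2 (det_innerMatrix_pos t.2)).ne'
  refine Continuous.div ?_ hdet hne
  simp only [fun t : Frame 2 E => frameForm_eq (det_innerMatrix_pos t.2) b b]
  exact ((((i11.mul i0b).mul i0b).sub (i01.mul ((i0b.mul i1b).add (i1b.mul i0b)))).add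
    ((i00.mul i1b).mul i1b)).div hdet hne

theorem projSq_nonneg (b : E) (S : OrientedGrassmannian 2 E) : 0 ≤ projSq b S := by
  induction S using Quotient.inductionOn with
  | h t => exact div_nonneg (frameForm_self_nonneg (det_innerMatrix_pos t.2) b) (Real.sqrt_nonneg _)

/-- If a nonzero vector of `P` is orthogonal to `S`, then `w(S, P) = 0`. -/
theorem w_eq_zero_of_projSq {S P : OrientedGrassmannian 2 E} {b : E} (hb : b ≠ 0)
    (hbP : b ∈ P.toSubmodule) (h : projSq b S = 0) : w S P = 0 := by
  induction S using Quotient.inductionOn with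
  | h t =>
  induction P using Quotient.inductionOn with
  | h u =>
  have ht := det_innerMatrix_pos t.2
  change frameForm t.1 b b / √(innerMatrix t.1 t.1).det = 0 at h
  rw [div_eq_zero_iff, or_iff_left (Real.sqrt_pos.2 ht).ne'] at h
  have hi := inner_eq_zero_of_frameForm_self ht h
  obtain ⟨c, hc⟩ := (Submodule.mem_span_range_iff_exists_fun ℝ).1 hbP
  have hc0 : c ≠ 0 := by
    rintro rfl
    apply hb
    simp [← hc]
  -- The coefficients of `b` in the frame `u` form a nonzero vector in the kernel of this matrix.
  have hdet : (innerMatrix t.1 u.1).det = 0 := by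
    refine Matrix.exists_mulVec_eq_zero_iff.1 ⟨c, hc0, ?_⟩
    funext i
    have := hi i
    rw [← hc, inner_sum] at this
    simpa [Matrix.mulVec, dotProduct, innerMatrix, real_inner_smul_right, mul_comm] using this
  change wFrame t.1 u.1 = 0
  rw [wFrame, hdet, zero_div]

/-- On a compact subset of `𝕎_0`, the orthogonal projections of some fixed vector are bounded
below. -/
theorem exists_projSq_bound {P Q : OrientedGrassmannian 2 E} (hPQ : P.SOrthogonal Q)
    {K : Set (OrientedGrassmannian 2 E)} (hK : IsCompact K) (hKW : K ⊆ W P Q 0) :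
    ∃ b : E, ∃ δ > 0, ∀ S ∈ K, δ ≤ projSq b S := by
  have hne : (P.toSubmodule ⊓ Q.toSubmodule : Submodule ℝ E) ≠ ⊥ := by
    intro h
    have := hPQ.1
    rw [h, finrank_bot] at this
    omega
  obtain ⟨b, hb, hb0⟩ := Submodule.exists_mem_ne_zero_of_ne_bot hne
  refine ⟨b, hK.exists_forall_le' (continuous_projSq b).continuousOn fun S hS => ?_⟩
  refine (projSq_nonneg b S).lt_of_ne' fun h => ?_
  have h1 := w_eq_zero_of_projSq hb0 hb.1 h
  have h2 := w_eq_zero_of_projSq hb0 hb.2 h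
  -- `b` lies in both planes, so the S-map takes the value `(0, 0)`, the only point of the removed
  -- disk of radius zero.
  refine (hKW hS).2 (Or.inl ?_)
  simp [closedDisk, sMap, h1, h2]

end OrientedGrassmannian

/-! ### Rigidity of parabolic minimal surfaces -/

section Rigidity

local notation "ℝ²" => EuclideanSpace ℝ (Fin 2)

variable {E : Type*} [NormedAddCommGroup E] [InnerProductSpace ℝ E]
variable {M : Type*} [TopologicalSpace M] [ChartedSpace (EuclideanSpace ℝ (Fin 2)) M]
  [IsManifold (𝓡 2) ∞ M] [RiemannianBundle (fun x : M => TangentSpace (𝓡 2) x)]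

/-- If the tangent planes are nowhere close to being orthogonal to a fixed vector, then every
vector normal to one tangent plane is normal to all of them. -/
theorem inner_tangentFrame_eq_zero {f : M → E} (hf : IsIsometricImmersion (n := 2) f)
    (hmin : IsMinimal (n := 2) f) (hor : IsOrientedAtlas 2 M) (hpar : IsParabolic 2 M)
    {b : E} {δ : ℝ} (hδ : 0 < δ)
    (hb : ∀ x, δ ≤ OrientedGrassmannian.projSq b (gaussMap f hf x)) {x₀ : M} {a : E}
    (ha : ∀ i, inner ℝ (tangentFrame (n := 2) f x₀ i) a = 0) (x : M) (i : Fin 2) :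
    inner ℝ (tangentFrame (n := 2) f x i) a = 0 := by
  have hdet := det_innerMatrix_tangentFrame_pos hf
  have hb' : ∀ x, δ ≤ frameForm (tangentFrame (n := 2) f x) b b /
    √(innerMatrix (tangentFrame (n := 2) f x) (tangentFrame (n := 2) f x)).det := hb
  have hpos : ∀ x, 0 < frameForm (tangentFrame (n := 2) f x) b b := by
    intro x
    by_contra! h
    have := div_nonpos_of_nonpos_of_nonneg h (Real.sqrt_nonneg
      (innerMatrix (tangentFrame (n := 2) f x) (tangentFrame (n := 2) f x)).det)
    linarith [hb' x]
  have hne : ∀ x, frameForm (tangentFrame (n := 2) f x) b b ≠ 0 := fun x => (hpos x).ne'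
  have hbound : ∀ x, tangentRe f b a x ^ 2 + tangentIm f b a x ^ 2 ≤ ‖a‖ ^ 2 / δ := fun x =>
    (frameRe_sq_add_frameIm_sq_le (hdet x) (hpos x)).trans (by gcongr; exact hb' x)
  have hRe : ∀ x, tangentRe f b a x = 0 := by
    obtain ⟨c, hc⟩ := hpar (tangentRe f b a) (contMDiff_tangentRe hf hor hne a)
      -- Only the square is bounded so far; `r ≤ r² + 1` accounts for the added `1`.
      ⟨‖a‖ ^ 2 / δ + 1, by
        rintro _ ⟨x, rfl⟩
        nlinarith [hbound x, sq_nonneg (tangentIm f b a x), sq_nonneg (tangentRe f b a x - 1)]⟩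
      (fun x => (laplaceBeltrami_tangentRe hf hmin hor hne a x).ge)
    intro x
    -- The constant is the value at `x₀`, where `a` is normal.
    rw [hc x, ← hc x₀]
    simp [tangentRe, frameRe, frameForm, flux, ha]
  have hIm : ∀ x, tangentIm f b a x = 0 := by
    obtain ⟨c, hc⟩ := hpar (tangentIm f b a) (contMDiff_tangentIm hf hor hne a)
      ⟨‖a‖ ^ 2 / δ + 1, by
        rintro _ ⟨x, rfl⟩
        nlinarith [hbound x, sq_nonneg (tangentRe f b a x), sq_nonneg (tangentIm f b a x - 1)]⟩
      (fun x => (laplaceBeltrami_tangentIm hf hmin hor hne a x).ge)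
    intro x
    rw [hc x, ← hc x₀]
    simp [tangentIm, frameIm, frameCross, ha]
  have e1 : frameRe (tangentFrame (n := 2) f x) b a = 0 := hRe x
  have e2 : frameIm (tangentFrame (n := 2) f x) b a = 0 := hIm x
  fin_cases i
  · simpa [e1, e2] using inner_zero_eq_frame (hdet x) (hne x) a
  · simpa [e1, e2] using inner_one_eq_frame (hdet x) (hne x) a

/-- The differential of `⟨f, a⟩` vanishes, so the function is constant on coordinate balls, which
are convex, and hence on the connected `M`. -/
theorem inner_eq_of_inner_tangentFrame [PreconnectedSpace M] {f : M → E}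
    (hf : IsIsometricImmersion (n := 2) f) {a : E}
    (ha : ∀ x i, inner ℝ (tangentFrame (n := 2) f x i) a = 0) (x y : M) :
    (inner ℝ (f x) a : ℝ) = inner ℝ (f y) a := by
  have hloc : IsLocallyConstant fun x => (inner ℝ (f x) a : ℝ) := by
    rw [IsLocallyConstant.iff_eventually_eq]
    intro x
    obtain ⟨r, hr, hball⟩ := Metric.isOpen_iff.1 (chart (n := 2) x).open_target _
      (mem_chart_target _ x)
    have hdiff : ∀ q ∈ Metric.ball (chart (n := 2) x x) r, HasFDerivAt
        (fun q => (inner ℝ ((f ∘ (chart (n := 2) x).symm) q) a : ℝ)) (0 : ℝ² →L[ℝ] ℝ) q := by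
      intro q hq
      have hd := (contDiffAt_comp_chart_symm hf.contMDiff x (hball hq)).differentiableAt
        (by simp)
      have hc : DifferentiableAt ℝ (fun _ : ℝ² => a) q := differentiableAt_const a
      obtain ⟨z, hz, rfl⟩ : ∃ z ∈ (chart (n := 2) x).source, chart x z = q :=
        ⟨(chart x).symm q, (chart x).map_target (hball hq), (chart x).right_inv (hball hq)⟩
      have hcoord : ∀ i, inner ℝ (coordFrame (f ∘ (chart (n := 2) x).symm) (chart x z) i) a
          = (0 : ℝ) := by
        intro i
        rw [tangentFrame_changeFrame hf.contMDiff hz, inner_changeFrame, ha, ha]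
        simp
      have h0 : fderiv ℝ (fun q => (inner ℝ ((f ∘ (chart (n := 2) x).symm) q) a : ℝ))
          (chart x z) = 0 := by
        ext v
        have e0 := hcoord 0
        have e1 := hcoord 1
        simp only [coordFrame] at e0 e1
        rw [fderiv_inner_apply ℝ hd hc, eq_sum_stdVec v]
        simp [inner_add_left, real_inner_smul_left, e0, e1]
      rw [← h0]
      exact (hd.inner ℝ hc).hasFDerivAt
    have hconst : ∀ q ∈ Metric.ball (chart (n := 2) x x) r,
        (inner ℝ ((f ∘ (chart (n := 2) x).symm) q) a : ℝ) =
          inner ℝ ((f ∘ (chart (n := 2) x).symm) (chart x x)) a := by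
      intro q hq
      exact (convex_ball _ r).is_const_of_fderivWithin_eq_zero (𝕜 := ℝ)
        (fun z hz => (hdiff z hz).differentiableAt.differentiableWithinAt)
        (fun z hz => ((hdiff z hz).hasFDerivWithinAt).fderivWithin
          (Metric.isOpen_ball.uniqueDiffWithinAt hz)) hq (Metric.mem_ball_self hr)
    have hcont : ContinuousAt (chart (n := 2) x) x :=
      (chart x).continuousAt (mem_chart_source _ x)
    filter_upwards [hcont (Metric.ball_mem_nhds _ hr), chart_source_mem_nhds ℝ² x] with y hy hys
    have := hconst _ hy
    simp only [Function.comp_apply] at this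
    rwa [(chart x).left_inv hys, (chart x).left_inv (mem_chart_source _ x)] at this
  exact hloc.apply_eq_of_isPreconnected isPreconnected_univ trivial trivial

theorem sub_mem_tangentPlane [PreconnectedSpace M] {f : M → E}
    (hf : IsIsometricImmersion (n := 2) f)
    (hmin : IsMinimal (n := 2) f) (hor : IsOrientedAtlas 2 M) (hpar : IsParabolic 2 M)
    {b : E} {δ : ℝ} (hδ : 0 < δ)
    (hb : ∀ x, δ ≤ OrientedGrassmannian.projSq b (gaussMap f hf x)) (x₀ x : M) :
    f x - f x₀ ∈ tangentPlane (n := 2) f x₀ := by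
  rw [← (tangentPlane (n := 2) f x₀).orthogonal_orthogonal, Submodule.mem_orthogonal']
  intro a ha
  have ha' : ∀ i, inner ℝ (tangentFrame (n := 2) f x₀ i) a = 0 := fun i =>
    (Submodule.mem_orthogonal _ a).1 ha _ (Submodule.subset_span ⟨i, rfl⟩)
  rw [inner_sub_left, sub_eq_zero]
  exact inner_eq_of_inner_tangentFrame hf
    (inner_tangentFrame_eq_zero hf hmin hor hpar hδ hb ha') x x₀

theorem finrank_tangentPlane {f : M → E} (hf : IsIsometricImmersion (n := 2) f) (x : M) :
    Module.finrank ℝ (tangentPlane (n := 2) f x) = 2 := by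
  rw [tangentPlane, finrank_span_eq_card (linearIndependent_tangentFrame hf x), Fintype.card_fin]

end Rigidity

end MinimalSurface

namespace MinimalSurface

open Filter Topology Set

/-! ### Complete flat immersions of codimension zero -/

section Flat

set_option linter.unusedSectionVars false

variable {n : ℕ} {W : Type*} [NormedAddCommGroup W] [InnerProductSpace ℝ W]
variable {M : Type*} [MetricSpace M] [ChartedSpace (EuclideanSpace ℝ (Fin n)) M]
  [IsManifold (𝓡 n) ∞ M] [RiemannianBundle (fun x : M => TangentSpace (𝓡 n) x)]

theorem enorm_mfderiv_eq {f : M → W} (hf : IsIsometricImmersion (n := n) f) (x : M)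
    (v : TangentSpace (𝓡 n) x) : ‖mfderiv (𝓡 n) 𝓘(ℝ, W) f x v‖ₑ = ‖v‖ₑ := by
  have h := hf.inner_mfderiv x v v
  have key : ∀ z : W, ‖z‖ₑ = ENNReal.ofReal √(inner ℝ z z) := fun z => by
    rw [← ofReal_norm, norm_eq_sqrt_real_inner]
  have hv : ‖v‖ₑ = ENNReal.ofReal √(inner ℝ v v) := by
    rw [← ofReal_norm, norm_eq_sqrt_real_inner]
  exact enorm_tangentSpace_vectorSpace.trans
    ((key _).trans ((congrArg (fun r => ENNReal.ofReal √r) h).trans hv.symm))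

theorem pathELength_comp_eq {f : M → W} (hf : IsIsometricImmersion (n := n) f) {γ : ℝ → M}
    {a b : ℝ} (hγ : ContMDiffOn 𝓘(ℝ, ℝ) (𝓡 n) 1 γ (Icc a b)) :
    Manifold.pathELength 𝓘(ℝ, W) (f ∘ γ) a b = Manifold.pathELength (𝓡 n) γ a b := by
  rw [Manifold.pathELength_eq_lintegral_mfderiv_Ioo, Manifold.pathELength_eq_lintegral_mfderiv_Ioo]
  refine MeasureTheory.setLIntegral_congr_fun measurableSet_Ioo fun t ht => ?_
  have h1 : MDifferentiableAt 𝓘(ℝ, ℝ) (𝓡 n) γ t :=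
    ((hγ t (Ioo_subset_Icc_self ht)).contMDiffAt (Icc_mem_nhds ht.1 ht.2)).mdifferentiableAt
      (by simp)
  have h2 : MDifferentiableAt (𝓡 n) 𝓘(ℝ, W) f (γ t) := (hf.contMDiff _).mdifferentiableAt (by simp)
  rw [mfderiv_comp t h2 h1]
  exact enorm_mfderiv_eq hf (γ t) _

/-- Paths in `M` have images of the same length, and distances are infima of lengths. -/
theorem edist_le_of_isIsometricImmersion [IsRiemannianManifold (𝓡 n) M] {f : M → W}
    (hf : IsIsometricImmersion (n := n) f) (x y : M) : edist (f x) (f y) ≤ edist x y := by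
  refine le_of_forall_gt fun r hr => ?_
  rw [IsRiemannianManifold.out (I := 𝓡 n) x y] at hr
  obtain ⟨γ, h0, h1, hγ, hlt⟩ := Manifold.exists_lt_of_riemannianEDist_lt hr
  rw [IsRiemannianManifold.out (I := 𝓘(ℝ, W)) (f x) (f y)]
  refine lt_of_le_of_lt (Manifold.riemannianEDist_le_pathELength (γ := f ∘ γ) (a := 0) (b := 1)
    ?_ (by simp [h0]) (by simp [h1]) zero_le_one) ((pathELength_comp_eq hf hγ).trans_lt hlt)
  exact (hf.contMDiff.of_le (by exact ENat.LEInfty.out)).comp_contMDiffOn hγ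

theorem pathELength_line (p v : W) {a b : ℝ} :
    Manifold.pathELength 𝓘(ℝ, W) (fun t : ℝ => p + t • v) a b = ENNReal.ofReal (‖v‖ * (b - a)) := by
  rw [Manifold.pathELength_eq_lintegral_mfderiv_Icc]
  have h : ∀ t : ℝ, ‖mfderiv 𝓘(ℝ, ℝ) 𝓘(ℝ, W) (fun t : ℝ => p + t • v) t 1‖ₑ = ‖v‖ₑ := by
    intro t
    rw [enorm_tangentSpace_vectorSpace, mfderiv_eq_fderiv]
    have : fderiv ℝ (fun t : ℝ => p + t • v) t 1 = v := by
      have hd : HasDerivAt (fun t : ℝ => p + t • v) v t := by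
        simpa using ((hasDerivAt_id t).smul_const v).const_add p
      exact hd.deriv
    exact congrArg _ this
  simp only [h, MeasureTheory.lintegral_const, MeasureTheory.Measure.restrict_apply_univ,
    Real.volume_Icc, ← ofReal_norm]
  rw [ENNReal.ofReal_mul (norm_nonneg _)]

variable [FiniteDimensional ℝ W]

/-- In equal dimensions the injective differential is invertible, so the inverse function theorem
applies in the chart. Smoothness of the inverse is kept because lifted paths must have a length. -/
theorem exists_local_inverse (hW : Module.finrank ℝ W = n) {f : M → W}
    (hf : IsIsometricImmersion (n := n) f) (y : M) : ∃ e : OpenPartialHomeomorph M W,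
      y ∈ e.source ∧ EqOn f e e.source ∧ ContMDiffAt 𝓘(ℝ, W) (𝓡 n) 1 e.symm (f y) := by
  have hk : ContDiffAt ℝ ∞ (f ∘ (chart (n := n) y).symm) (chart y y) := by
    rw [← contMDiffAt_iff_contDiffAt]
    exact (hf.contMDiff _).comp _ ((contMDiffOn_chart_symm (I := 𝓡 n) (n := ∞)).contMDiffAt
      ((chart y).open_target.mem_nhds (mem_chart_target _ y)))
  have hd := (hk.differentiableAt (by simp)).hasFDerivAt
  have hinj : Function.Injective (fderiv ℝ (f ∘ (chart (n := n) y).symm) (chart y y)) := by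
    have hli := linearIndependent_tangentFrame hf y
    rw [injective_iff_map_eq_zero]
    intro v hv
    have hv' : v = ∑ i, v i • stdVec i := by
      ext j
      simp [stdVec, Finset.sum_apply, Pi.single_apply]
    rw [hv', map_sum] at hv
    simp only [map_smul] at hv
    have := Fintype.linearIndependent_iff.1 hli (fun i => v i) hv
    ext i
    exact this i
  let L : EuclideanSpace ℝ (Fin n) ≃L[ℝ] W := (LinearEquiv.ofInjectiveOfFinrankEq
    (fderiv ℝ (f ∘ (chart (n := n) y).symm) (chart y y)).toLinearMap hinj
      (by simp [hW])).toContinuousLinearEquiv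
  have hL : HasFDerivAt (f ∘ (chart (n := n) y).symm)
      (L : EuclideanSpace ℝ (Fin n) →L[ℝ] W) (chart y y) := by
    convert! hd using 1
  let k := hk.toOpenPartialHomeomorph _ hL (by simp)
  refine ⟨(chart y).trans k, ?_, ?_, ?_⟩
  · rw [OpenPartialHomeomorph.trans_source]
    exact ⟨mem_chart_source _ y, hk.mem_toOpenPartialHomeomorph_source hL (by simp)⟩
  · intro z hz
    rw [OpenPartialHomeomorph.trans_source] at hz
    have : k (chart y z) = (f ∘ (chart (n := n) y).symm) (chart y z) := rfl
    rw [OpenPartialHomeomorph.trans_apply, this, Function.comp_apply, (chart y).left_inv hz.1]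
  · have h1 : ContDiffAt ℝ ∞ k.symm ((f ∘ (chart (n := n) y).symm) (chart y y)) :=
      hk.to_localInverse hL (by simp)
    have hsymm : k.symm (f y) = chart y y := by
      have := k.left_inv (hk.mem_toOpenPartialHomeomorph_source hL (by simp))
      have h2 : k (chart y y) = f y := by
        change f ((chart (n := n) y).symm (chart y y)) = f y
        rw [(chart y).left_inv (mem_chart_source _ y)]
      rwa [h2] at this
    rw [Function.comp_apply, (chart y).left_inv (mem_chart_source _ y)] at h1
    have h3 : ContMDiffAt (𝓡 n) (𝓡 n) ∞ (chart (n := n) y).symm (k.symm (f y)) := by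
      rw [hsymm]
      exact (contMDiffOn_chart_symm (I := 𝓡 n) (n := ∞)).contMDiffAt
        ((chart y).open_target.mem_nhds (mem_chart_target _ y))
    exact (h3.comp (f y) (contMDiffAt_iff_contDiffAt.2 h1)).of_le ENat.LEInfty.out

theorem isLocalHomeomorph_of_isIsometricImmersion (hW : Module.finrank ℝ W = n) {f : M → W}
    (hf : IsIsometricImmersion (n := n) f) : IsLocalHomeomorph f :=
  .mk f fun y => by
    obtain ⟨e, hy, he, -⟩ := exists_local_inverse hW hf y
    exact ⟨e, hy, he⟩

theorem contMDiffOn_of_lift (hW : Module.finrank ℝ W = n) {f : M → W}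
    (hf : IsIsometricImmersion (n := n) f) {Γ : ℝ → M} {l : ℝ → W} {s : Set ℝ}
    (hl : ContDiff ℝ 1 l) (hΓ : ContinuousOn Γ s) (h : ∀ t ∈ s, f (Γ t) = l t) :
    ContMDiffOn 𝓘(ℝ, ℝ) (𝓡 n) 1 Γ s := by
  intro t ht
  obtain ⟨e, hy, he, hs⟩ := exists_local_inverse hW hf (Γ t)
  rw [h t ht] at hs
  have hev : ∀ᶠ z in 𝓝[s] t, Γ z = (e.symm ∘ l) z := by
    filter_upwards [(hΓ t ht).eventually (e.open_source.mem_nhds hy), self_mem_nhdsWithin]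
      with z hz hzs
    rw [Function.comp_apply, ← h z hzs, he hz, e.left_inv hz]
  refine ContMDiffWithinAt.congr_of_eventuallyEq_of_mem ?_ hev ht
  exact (hs.comp t (contMDiffAt_iff_contDiffAt.2 hl.contDiffAt)).contMDiffWithinAt

/-- The lift is `C¹` and has the same length as the segment below it. -/
theorem dist_le_of_lift [IsRiemannianManifold (𝓡 n) M] (hW : Module.finrank ℝ W = n) {f : M → W}
    (hf : IsIsometricImmersion (n := n) f) {Γ : ℝ → M} {p v : W} {a b : ℝ} (hab : a ≤ b)
    (hΓ : ContinuousOn Γ (Icc a b)) (h : ∀ t ∈ Icc a b, f (Γ t) = p + t • v) :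
    dist (Γ a) (Γ b) ≤ ‖v‖ * (b - a) := by
  have hl : ContDiff ℝ 1 fun t : ℝ => p + t • v := by fun_prop
  have hs := contMDiffOn_of_lift hW hf hl hΓ h
  have hpos : 0 ≤ ‖v‖ * (b - a) := mul_nonneg (norm_nonneg _) (sub_nonneg.2 hab)
  rw [← edist_le_ofReal hpos, IsRiemannianManifold.out (I := 𝓡 n), ← pathELength_line p v,
    ← Manifold.pathELength_congr (γ := f ∘ Γ) h, pathELength_comp_eq hf hs]
  exact Manifold.riemannianEDist_le_pathELength hs rfl rfl hab

/-- Uniqueness of lifts: `f` is locally injective, `M` is Hausdorff and the interval is connected.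
-/
theorem eqOn_of_lift (hW : Module.finrank ℝ W = n) {f : M → W}
    (hf : IsIsometricImmersion (n := n) f) {Γ Γ' : ℝ → M} {l : ℝ → W} {T : ℝ} (hT : 0 ≤ T)
    (hΓ : ContinuousOn Γ (Icc 0 T)) (h : ∀ t ∈ Icc 0 T, f (Γ t) = l t)
    (hΓ' : ContinuousOn Γ' (Icc 0 T)) (h' : ∀ t ∈ Icc 0 T, f (Γ' t) = l t) (h0 : Γ 0 = Γ' 0) :
    EqOn Γ Γ' (Icc 0 T) :=
  (T2Space.isSeparatedMap f).eqOn_of_comp_eqOn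
    (isLocalHomeomorph_of_isIsometricImmersion hW hf).isLocallyInjective isPreconnected_Icc hΓ hΓ'
    (fun t ht => (h t ht).trans (h' t ht).symm) (left_mem_Icc.2 hT) h0

end Flat

end MinimalSurface

namespace MinimalSurface

open Filter Topology Set

/-! ### Lifting segments to a complete manifold -/

section Complete

set_option linter.unusedSectionVars false

variable {n : ℕ} {W : Type*} [NormedAddCommGroup W] [InnerProductSpace ℝ W]
  [FiniteDimensional ℝ W]
variable {M : Type*} [MetricSpace M] [ChartedSpace (EuclideanSpace ℝ (Fin n)) M]
  [IsManifold (𝓡 n) ∞ M] [RiemannianBundle (fun x : M => TangentSpace (𝓡 n) x)]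
  [IsRiemannianManifold (𝓡 n) M]

/-- `Γ` lifts the segment `t ↦ f y + t • v`, `0 ≤ t ≤ T`, to a path starting at `y`. -/
structure IsSegmentLift (f : M → W) (y : M) (v : W) (T : ℝ) (Γ : ℝ → M) : Prop where
  continuousOn : ContinuousOn Γ (Icc 0 T)
  zero : Γ 0 = y
  apply : ∀ t ∈ Icc 0 T, f (Γ t) = f y + t • v

theorem IsSegmentLift.mono {f : M → W} {y : M} {v : W} {S T : ℝ} {Γ : ℝ → M}
    (h : IsSegmentLift f y v T Γ) (hST : S ≤ T) : IsSegmentLift f y v S Γ :=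
  ⟨h.continuousOn.mono (Icc_subset_Icc_right hST), h.zero,
    fun t ht => h.apply t (Icc_subset_Icc_right hST ht)⟩

/-- The lift is continued beyond `T` by a local inverse of `f` at its endpoint. -/
theorem IsSegmentLift.exists_extension (hW : Module.finrank ℝ W = n) {f : M → W}
    (hf : IsIsometricImmersion (n := n) f) {y : M} {v : W} {T : ℝ} (hT : 0 ≤ T) {Γ : ℝ → M}
    (h : IsSegmentLift f y v T Γ) : ∃ ε > 0, ∀ S < T + ε, ∃ Γ', IsSegmentLift f y v S Γ' := by
  obtain ⟨e, hy, he, -⟩ := exists_local_inverse hW hf (Γ T)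
  have hl : Continuous fun t : ℝ => f y + t • v := by fun_prop
  have hTT := h.apply T (right_mem_Icc.2 hT)
  have hmem : ∀ᶠ t in 𝓝 T, f y + t • v ∈ e.target := by
    refine hl.continuousAt.eventually (e.open_target.mem_nhds ?_)
    simp only
    rw [← hTT, he hy]
    exact e.map_source hy
  obtain ⟨ε, hε, hball⟩ := Metric.eventually_nhds_iff_ball.1 hmem
  have htarget : ∀ t, T ≤ t → t < T + ε → f y + t • v ∈ e.target := fun t h1 h2 =>
    hball t (by rw [Metric.mem_ball, Real.dist_eq, abs_lt]; constructor <;> linarith)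
  have hglue : e.symm (f y + T • v) = Γ T := by rw [← hTT, he hy, e.left_inv hy]
  refine ⟨ε, hε, fun S hS => ⟨fun t => if t ≤ T then Γ t else e.symm (f y + t • v), ?_, ?_, ?_⟩⟩
  · refine ContinuousOn.if ?_ ?_ ?_
    · rintro t ⟨-, ht⟩
      have : t = T := frontier_Iic_subset T ht
      rw [this, hglue]
    · refine h.continuousOn.mono fun t ht => ⟨ht.1.1, ?_⟩
      have := ht.2
      rwa [show {a : ℝ | a ≤ T} = Iic T from rfl, closure_Iic] at this
    · refine e.symm.continuousOn.comp hl.continuousOn fun t ht => ?_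
      have h2 := ht.2
      rw [show {a : ℝ | ¬a ≤ T} = Ioi T by ext; simp, closure_Ioi] at h2
      exact htarget t h2 (ht.1.2.trans_lt hS)
  · simp [hT, h.zero]
  · intro t ht
    by_cases hc : t ≤ T
    · simpa [hc] using h.apply t ⟨ht.1, hc⟩
    · have hm := htarget t (not_le.1 hc).le (ht.2.trans_lt hS)
      simp only [hc, if_false]
      rw [he (e.map_target hm), e.right_inv hm]

/-- Lifts over shorter intervals agree by uniqueness and are `‖v‖`-Lipschitz, since lifting
preserves length. So the combined path is Cauchy at `T`, and completeness supplies the endpoint. -/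
theorem exists_isSegmentLift_of_lt [CompleteSpace M] (hW : Module.finrank ℝ W = n) {f : M → W}
    (hf : IsIsometricImmersion (n := n) f) {y : M} {v : W} {T : ℝ} (hT : 0 < T)
    (h : ∀ t, 0 ≤ t → t < T → ∃ Γ, IsSegmentLift f y v t Γ) : ∃ Γ, IsSegmentLift f y v T Γ := by
  have h' : ∀ t, ∃ Γ : ℝ → M, t ∈ Ico 0 T → IsSegmentLift f y v t Γ := fun t => by
    by_cases ht : t ∈ Ico 0 T
    · obtain ⟨Γ, hΓ⟩ := h t ht.1 ht.2
      exact ⟨Γ, fun _ => hΓ⟩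
    · exact ⟨fun _ => y, fun h => absurd h ht⟩
  choose G hG using h'
  -- The combined path takes at time `t` the endpoint of the lift over `[0, t]`.
  set R : ℝ → M := fun t => G t t with hR
  have hcoh : ∀ s ∈ Ico 0 T, ∀ t ∈ Ico 0 T, s ≤ t → R s = G t s := fun s hs t ht hst =>
    eqOn_of_lift hW hf hs.1 (hG s hs).continuousOn (hG s hs).apply
      ((hG t ht).mono hst).continuousOn ((hG t ht).mono hst).apply
      ((hG s hs).zero.trans (hG t ht).zero.symm) (right_mem_Icc.2 hs.1)
  have hdist : ∀ s ∈ Ico 0 T, ∀ t ∈ Ico 0 T, s ≤ t → dist (R s) (R t) ≤ ‖v‖ * (t - s) := by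
    intro s hs t ht hst
    rw [hcoh s hs t ht hst]
    exact dist_le_of_lift hW hf hst ((hG t ht).continuousOn.mono (Icc_subset_Icc_left hs.1))
      (fun r hr => (hG t ht).apply r ⟨hs.1.trans hr.1, hr.2⟩)
  have hlip : LipschitzOnWith ‖v‖₊ R (Ico 0 T) := by
    refine LipschitzOnWith.of_dist_le_mul fun s hs t ht => ?_
    rw [Real.dist_eq, coe_nnnorm]
    rcases le_total s t with hst | hst
    · rw [abs_sub_comm, abs_of_nonneg (sub_nonneg.2 hst)]
      exact hdist s hs t ht hst
    · rw [dist_comm, abs_of_nonneg (sub_nonneg.2 hst)]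
      exact hdist t ht s hs hst
  have hne : (𝓝[Ico 0 T] T).NeBot := by
    rw [← mem_closure_iff_nhdsWithin_neBot, closure_Ico hT.ne]
    exact right_mem_Icc.2 hT.le
  have hcauchy : Cauchy (map R (𝓝[Ico 0 T] T)) :=
    Cauchy.map_of_le (cauchy_nhds.mono nhdsWithin_le_nhds) hlip.uniformContinuousOn
      (le_principal_iff.2 self_mem_nhdsWithin)
  obtain ⟨z, hz⟩ := CompleteSpace.complete hcauchy
  have hz' : Tendsto R (𝓝[Ico 0 T] T) (𝓝 z) := hz
  have hRapply : ∀ t ∈ Ico 0 T, f (R t) = f y + t • v := fun t ht =>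
    (hG t ht).apply t (right_mem_Icc.2 ht.1)
  refine ⟨Function.update R T z, ?_, ?_, ?_⟩
  · rw [continuousOn_update_iff, Icc_sdiff_right]
    exact ⟨hlip.continuousOn, fun _ => hz'⟩
  · rw [Function.update_of_ne hT.ne]
    exact (hG 0 ⟨le_rfl, hT⟩).zero
  · intro t ht
    rcases ht.2.eq_or_lt with rfl | hlt
    · rw [Function.update_self]
      have hl : Continuous fun s : ℝ => f y + s • v := by fun_prop
      have h1 : Tendsto (fun s => f (R s)) (𝓝[Ico 0 t] t) (𝓝 (f z)) :=
        (hf.contMDiff.continuous.tendsto z).comp hz'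
      have h2 : Tendsto (fun s : ℝ => f y + s • v) (𝓝[Ico 0 t] t) (𝓝 (f y + t • v)) :=
        (hl.tendsto t).mono_left nhdsWithin_le_nhds
      refine tendsto_nhds_unique h1 (h2.congr' ?_)
      filter_upwards [self_mem_nhdsWithin] with s hs using (hRapply s hs).symm
    · rw [Function.update_of_ne hlt.ne]
      exact hRapply t ⟨ht.1, hlt⟩

/-- Segments lift to complete manifolds. -/
theorem exists_isSegmentLift [CompleteSpace M] (hW : Module.finrank ℝ W = n) {f : M → W}
    (hf : IsIsometricImmersion (n := n) f) (y : M) (v : W) : ∃ Γ, IsSegmentLift f y v 1 Γ := by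
  have hmono : ∀ s t, s ≤ t → (∃ Γ, IsSegmentLift f y v t Γ) → ∃ Γ, IsSegmentLift f y v s Γ :=
    fun s t hst ⟨Γ, hΓ⟩ => ⟨Γ, hΓ.mono hst⟩
  have hzero : ∃ Γ, IsSegmentLift f y v 0 Γ :=
    ⟨fun _ => y, continuousOn_const, rfl, fun t ht => by
      rw [Icc_self, mem_singleton_iff] at ht
      simp [ht]⟩
  have hsub : Icc (0 : ℝ) 1 ⊆ {t | ∃ Γ, IsSegmentLift f y v t Γ} := by
    -- Continuity argument: the times up to which a lift exists form a closed subset of `[0, 1]`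
    -- that contains `0` and can be extended to the right.
    refine IsClosed.Icc_subset_of_forall_exists_gt ?_ hzero ?_
    · refine isClosed_of_closure_subset fun T hT => ?_
      have hT1 : T ∈ Icc (0 : ℝ) 1 := closure_minimal inter_subset_right isClosed_Icc hT
      refine ⟨?_, hT1⟩
      rcases hT1.1.eq_or_lt with h0 | hpos
      · rw [← h0]
        exact hzero
      refine exists_isSegmentLift_of_lt hW hf hpos fun t _ ht => ?_
      obtain ⟨s, hs, hs'⟩ := mem_closure_iff.1 hT (Ioi t) isOpen_Ioi ht
      exact hmono t s (le_of_lt hs) hs'.1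
    · rintro T ⟨⟨Γ, hΓ⟩, hT⟩ z hz
      obtain ⟨ε, hε, hS⟩ := hΓ.exists_extension hW hf hT.1
      have hz : T < z := hz
      refine ⟨min z (T + ε / 2), hS _ ?_, ?_, min_le_left _ _⟩
      · exact (min_le_right _ _).trans_lt (by linarith)
      · exact lt_min hz (by linarith)
  exact hsub ⟨zero_le_one, le_rfl⟩

/-- A local isometry from a connected complete Riemannian manifold to a Euclidean space of the same
dimension is a global isometry. -/
theorem isometry_surjective_of_complete [CompleteSpace M] [ConnectedSpace M]
    (hW : Module.finrank ℝ W = n) {f : M → W} (hf : IsIsometricImmersion (n := n) f) :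
    Isometry f ∧ Function.Surjective f := by
  have hloc := isLocalHomeomorph_of_isIsometricImmersion hW hf
  have hcont := hf.contMDiff.continuous
  obtain ⟨y⟩ := (inferInstance : Nonempty M)
  choose Γ hΓ using exists_isSegmentLift hW hf y
  have hH : Continuous fun q : unitInterval × W => f y + (q.1 : ℝ) • q.2 := by fun_prop
  -- Continuity of the lift in time alone, and of its starting point in `v`, gives joint continuity
  -- because `f` is a separated local homeomorphism.
  have hg : Continuous fun q : unitInterval × W => Γ q.2 q.1 := by
    refine hloc.continuous_lift (T2Space.isSeparatedMap f) ⟨_, hH⟩ ?_ ?_ ?_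
    · funext q
      exact (hΓ q.2).apply q.1 q.1.2
    · simp only [Set.Icc.coe_zero, fun v => (hΓ v).zero]
      exact continuous_const
    · intro v
      exact (hΓ v).continuousOn.comp_continuous continuous_subtype_val fun t => t.2
  -- The inverse exponential picture: `e w` is the endpoint of the lift, from `y`, of the segment
  -- from `f y` to `w`. This is a section of `f`.
  set e : W → M := fun w => Γ (w - f y) 1 with he
  have hecont : Continuous e :=
    hg.comp (Continuous.prodMk (continuous_const (y := (1 : unitInterval)))
      (continuous_id.sub continuous_const))
  have hfe : ∀ w, f (e w) = w := fun w => by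
    have := (hΓ (w - f y)).apply 1 (right_mem_Icc.2 zero_le_one)
    simpa using this
  have hclopen : IsClopen (range e) := by
    have hrange : range e = {z | e (f z) = z} := by
      ext z
      exact ⟨fun ⟨w, hw⟩ => by rw [mem_ofPred_eq, ← hw, hfe], fun hz => ⟨f z, hz⟩⟩
    constructor
    · rw [hrange]
      exact isClosed_eq (hecont.comp hcont) continuous_id
    -- For `x` near a point `z` of the range, `x` and `e (f x)` lie in a neighbourhood on which `f`
    -- is injective, and they have the same image, so they coincide.
    · rw [isOpen_iff_mem_nhds]
      intro z hz
      rw [hrange] at hz ⊢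
      obtain ⟨k, hk, rfl⟩ := hloc z
      have h1 : ∀ᶠ x in 𝓝 z, e (k x) ∈ k.source := by
        refine (hecont.comp hcont).continuousAt.eventually (k.open_source.mem_nhds ?_)
        rw [Function.comp_apply, show e (k z) = z from hz]
        exact hk
      filter_upwards [h1, k.open_source.mem_nhds hk] with x hx hx'
      exact k.injOn hx hx' (hfe _)
  have huniv : range e = univ := hclopen.eq_univ (range_nonempty e)
  have hinj : Function.Injective f := by
    have hleft : ∀ z, e (f z) = z := fun z => by
      obtain ⟨w, rfl⟩ : z ∈ range e := huniv ▸ mem_univ z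
      rw [hfe]
    exact Function.LeftInverse.injective hleft
  refine ⟨fun x x' => le_antisymm (edist_le_of_isIsometricImmersion hf x x') ?_,
    fun w => ⟨e w, hfe w⟩⟩
  -- For the reverse inequality, the segment from `f x` to `f x'` is lifted from `x`; by injectivity
  -- the lift ends at `x'`.
  obtain ⟨γ, hγ⟩ := exists_isSegmentLift hW hf x (f x' - f x)
  have h1 : γ 1 = x' := hinj (by
    have := hγ.apply 1 (right_mem_Icc.2 zero_le_one)
    simpa using this)
  have h2 := dist_le_of_lift hW hf zero_le_one hγ.continuousOn hγ.apply
  rw [hγ.zero, h1, sub_zero, mul_one, ← dist_eq_norm, dist_comm (f x') (f x)] at h2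
  rw [edist_dist, edist_dist]
  exact ENNReal.ofReal_le_ofReal h2

end Complete

end MinimalSurface

/-! ### Restriction to the affine plane and conclusion -/

namespace MinimalSurface

/-- An isometric immersion with values in an affine subspace is an isometric immersion into it. -/
theorem IsIsometricImmersion.codRestrict {n : ℕ} {M : Type*} [TopologicalSpace M]
    [ChartedSpace (EuclideanSpace ℝ (Fin n)) M]
    [RiemannianBundle (fun x : M => TangentSpace (𝓡 n) x)]
    {E : Type*} [NormedAddCommGroup E] [InnerProductSpace ℝ E] {f : M → E}
    (hf : IsIsometricImmersion (n := n) f) (S : Submodule ℝ E) [S.HasOrthogonalProjection] (c : E)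
    (h : ∀ x, f x - c ∈ S) :
    IsIsometricImmersion (n := n) fun x => (⟨f x - c, h x⟩ : S) := by
  have hsmooth : ContMDiff (𝓡 n) 𝓘(ℝ, S) ∞ fun x => (⟨f x - c, h x⟩ : S) := by
    -- The orthogonal projection extends the restriction of codomain to a smooth map on all of `E`.
    have h1 : ContDiff ℝ ∞ fun z : E => S.orthogonalProjectionOnto (z - c) :=
      S.orthogonalProjectionOnto.contDiff.comp (contDiff_id.sub contDiff_const)
    have h2 : (fun x => (⟨f x - c, h x⟩ : S)) =
        (fun z : E => S.orthogonalProjectionOnto (z - c)) ∘ f := by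
      funext x
      exact (S.orthogonalProjectionOnto_mem_subspace_eq_self ⟨f x - c, h x⟩).symm
    rw [h2]
    exact h1.contMDiff.comp hf.contMDiff
  refine ⟨hsmooth, fun x v v' => ?_⟩
  have hd := ((hsmooth x).mdifferentiableAt (by simp)).hasMFDerivAt
  have hs : HasFDerivAt (fun z : S => (z : E) + c) S.subtypeL ⟨f x - c, h x⟩ :=
    S.subtypeL.hasFDerivAt.add_const c
  have hcomp := hs.hasMFDerivAt.comp x hd
  have hfun : (fun z : S => (z : E) + c) ∘ (fun x => (⟨f x - c, h x⟩ : S)) = f := by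
    funext y
    simp
  rw [hfun] at hcomp
  rw [← hf.inner_mfderiv x v v', hcomp.mfderiv]
  rfl

end MinimalSurface

end

theorem mainTheorem4 {m : ℕ} {M : Type*} [MetricSpace M] [ConnectedSpace M]
    [ChartedSpace (EuclideanSpace ℝ (Fin 2)) M] [IsManifold (𝓡 2) ∞ M]
    [RiemannianBundle (fun x : M => TangentSpace (𝓡 2) x)]
    [IsContMDiffRiemannianBundle (𝓡 2) ∞ (EuclideanSpace ℝ (Fin 2))
      (fun x : M => TangentSpace (𝓡 2) x)]
    [IsRiemannianManifold (𝓡 2) M]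
    (hor : IsOrientedAtlas 2 M) (hpar : IsParabolic 2 M)
    (f : M → EuclideanSpace ℝ (Fin (2 + m))) (hf : IsIsometricImmersion (n := 2) f)
    (hmin : IsMinimal (n := 2) f)
    (P Q : OrientedGrassmannian 2 (EuclideanSpace ℝ (Fin (2 + m)))) (hPQ : P.SOrthogonal Q)
    (K : Set (OrientedGrassmannian 2 (EuclideanSpace ℝ (Fin (2 + m)))))
    (hK : IsCompact K) (hKW : K ⊆ OrientedGrassmannian.W P Q 0) (hGauss : Set.range (gaussMap f hf) ⊆ K) :
    ∃ A : AffineSubspace ℝ (EuclideanSpace ℝ (Fin (2 + m))),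
      Module.finrank ℝ A.direction = 2 ∧ Set.range f ⊆ A ∧
        (CompleteSpace M → Isometry f ∧ Set.range f = A) := by
  obtain ⟨b, δ, hδ, hb⟩ := OrientedGrassmannian.exists_projSq_bound hPQ hK hKW
  have hb' : ∀ x, δ ≤ OrientedGrassmannian.projSq b (gaussMap f hf x) := fun x =>
    hb _ (hGauss ⟨x, rfl⟩)
  obtain ⟨x₀⟩ := (inferInstance : Nonempty M)
  have hmem := sub_mem_tangentPlane hf hmin hor hpar hδ hb' x₀
  have hrank := finrank_tangentPlane hf x₀
  refine ⟨AffineSubspace.mk' (f x₀) (tangentPlane (n := 2) f x₀), ?_, ?_, fun hcomplete => ?_⟩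
  · rw [AffineSubspace.direction_mk', hrank]
  · rintro _ ⟨x, rfl⟩
    exact AffineSubspace.mem_mk'.2 (hmem x)
  -- After translation by `f x₀`, `f` becomes an isometric immersion into its tangent plane at `x₀`,
  -- which has the dimension of `M`.
  · obtain ⟨hiso, hsurj⟩ := isometry_surjective_of_complete hrank (hf.codRestrict _ (f x₀) hmem)
    refine ⟨Isometry.of_dist_eq fun x y => ?_, Set.Subset.antisymm ?_ fun z hz => ?_⟩
    · have h := hiso.dist_eq x y
      rwa [Subtype.dist_eq, dist_sub_right] at h
    · rintro _ ⟨x, rfl⟩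
      exact AffineSubspace.mem_mk'.2 (hmem x)
    · obtain ⟨x, hx⟩ := hsurj ⟨z - f x₀, AffineSubspace.mem_mk'.1 hz⟩
      exact ⟨x, sub_left_injective (congrArg Subtype.val hx)⟩
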